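/- **Setting.** Let $(K,d)$ be a compact metric space, $N\ge 2$, and let $\gamma=(\gamma_0,\dots,\gamma_{N-1})$ be a self-similar map on $K$: each $\gamma_i:K\to K$ satisfies $c'd(x,y)\le d(\gamma_i(x),\gamma_i(y))\le c\,d(x,y)$ for some constants $0<c'\le c<1$, and $K=\bigcup_i\gamma_i(K)$. For a word $w=(i_1,\dots,i_n)\in\{0,\dots,N-1\}^n$ put $\gamma_w=\gamma_{i_n}\circ\cdots\circ\gamma_{i_1}$. Let $$B_\gamma=\{b : b=\gamma_i(a)=\gamma_j(a)\text{ for some }a\in K,\ i\ne j\},\qquad P_\gamma=\{a\in K : \gamma_w(a)\in B_\gamma\text{ for some word }w\text{ of length}\ge1\}.$$ Assume (Assumption B): there is a continuous $h:K\to K$ with $h(\gamma_j(y))=y$ for all $j$ and $y$; $B_\gamma$ is finite; and $B_\gamma\cap P_\gamma=\emptyset$. Let $A=C(K)$, let $X=X_\gamma=C(\{(\gamma_j(y),y)\})$ be the $A$-$A$ correspondence with $(a\cdot f\cdot b)(x,y)=a(x)f(x,y)b(y)$ and $(f|g)_A(y)=\sum_j\overline{f(\gamma_j(y),y)}\,g(\gamma_j(y),y)$,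 and identify its $n$-th tensor power with $X^{\otimes n}=X_{\gamma^n}=C(\{(\gamma_w(y),y):|w|=n\})$. Let $\mathcal K(X^{\otimes r})$ be the closed linear span of the rank one operators $\theta_{x,y}(z)=x(y|z)_A$ on $X^{\otimes r}$, and let $$\mathcal F^{(n)}=\sum_{r=0}^n\mathcal K(X^{\otimes r})\otimes I_{n-r}$$ be the finite core, an algebra of operators on $X^{\otimes n}$. Index the rows and columns of $M_{N^n}(\mathbb C)$ by words of length $n$. Put $\varphi(\xi)=(\xi(\gamma_w(\cdot),\cdot))_w$ for $\xi\in X^{\otimes r}$; this identifies $X^{\otimes r}$ with $$Z_{\gamma^r}=\{(f_w)_w\in A^{N^r} : f_w(c)=f_{w'}(c)\text{ whenever }\gamma_w(c)=\gamma_{w'}(c)\}.$$ Let $\Omega^{(r)}:\mathcal K(X^{\otimes r})\to M_{N^r}(A)=C(K,M_{N^r}(\mathbb C))$ be the representation determined by $\Omega^{(r)}(\theta_{x,y})=[\varphi(x)_w\overline{\varphi(y)_{w'}}]_{w,w'}$. For $M\in M_{N^r}(A)$ let $M\otimes I_{n-r}\in M_{N^n}(A)$ be the matrix whose fiber at $y$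 is block diagonal, with block $M(\gamma_u(y))$ at each word $u$ of length $n-r$ (the first $n-r$ letters of the index). Let $\Pi^{(n)}:\mathcal F^{(n)}\to M_{N^n}(A)$ be the matrix representation $$\Pi^{(n)}\Bigl(\sum_{r} T_r\otimes I_{n-r}\Bigr)=\sum_{r}\Omega^{(r)}(T_r)\otimes I_{n-r}.$$ For $\mathcal A\subseteq\mathcal F^{(n)}$ and $P\in K$ write $\Pi^{(n)}(\mathcal A)(P)=\{\Pi^{(n)}(T)(P):T\in\mathcal A\}\subseteq M_{N^n}(\mathbb C)$. Let $Q_{\gamma^n}(P)\in M_{N^n}(\mathbb C)$ be the orthogonal projection onto $Z_{\gamma^n}(P)=\{(f_w(P))_w : f\in Z_{\gamma^n}\}\subseteq\mathbb C^{N^n}$. For $1\le p\le n$ and $R\in B_\gamma$ with $h^p(R)=P$ put $$\tilde C(P,R,p)=\Bigl\{\sum_{u}\pi_{n-p,u}(A) : A\in M_{N^{n-p}}(\mathbb C)\Bigr\},$$ where $u$ runs through the words of length $p$ with $\gamma_u(P)=R$ and $\pi_{n-p,u}(A)$ is the block diagonal matrix with block $A$ at $u$ and $0$ elsewhere, and put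 $$C(P,R,p)=(I-Q_{\gamma^n}(P))\,\tilde C(P,R,p).$$ **Theorem.** Let $P\in P_\gamma$ and $n\ge0$. Then $\Pi^{(n)}(\mathcal F^{(n)})(P)$, $\Pi^{(n)}(\mathcal K(X^{\otimes n}))(P)$ and all $C(P,R,p)$ are $*$-subalgebras of $M_{N^n}(\mathbb C)$, each $C(P,R,p)$ is isomorphic as a $*$-algebra to $M_{N^{n-p}}(\mathbb C)$, and $$\Pi^{(n)}(\mathcal F^{(n)})(P)=\Pi^{(n)}(\mathcal K(X^{\otimes n}))(P)\ \oplus\bigoplus_{\substack{1\le p\le n,\ R\in B_\gamma\\ h^p(R)=P}}C(P,R,p)$$ is an internal direct sum of $*$-algebras: $(k,(c_{R,p}))\mapsto k+\sum_{R,p}c_{R,p}$ is a $*$-isomorphism from the direct sum of the algebras on the right onto the algebra on the left. -/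

import Mathlib

open scoped Classical

noncomputable section

/-- A proper contraction of a metric space:
`c' d(x, y) ≤ d(f x, f y) ≤ c d(x, y)` for some constants `0 < c' ≤ c < 1`. -/
def IsProperContraction {K : Type*} [MetricSpace K] (f : K → K) : Prop :=
  ∃ c' c : ℝ, 0 < c' ∧ c' ≤ c ∧ c < 1 ∧
    ∀ x y, c' * dist x y ≤ dist (f x) (f y) ∧ dist (f x) (f y) ≤ c * dist x y

/-- A self-similar map `γ = (γ_0, …, γ_{N-1})`, `N ≥ 2`, on a metric space `K`. -/
structure SelfSimilarMap (K : Type*) [MetricSpace K] (N : ℕ) where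
  γ : Fin N → K → K
  two_le : 2 ≤ N
  proper : ∀ i, IsProperContraction (γ i)
  cover : ⋃ i, Set.range (γ i) = Set.univ

/-- Words `(i_1, …, i_n)` in `{0, …, N-1}^n`. They index the rows and columns of `N^n × N^n`
matrices, in place of the numbers `i_1 N^(n-1) + ⋯ + i_n`. -/
abbrev Word (N n : ℕ) : Type := Fin n → Fin N

/-- `(i_1, …, i_s)` -/
def Word.take {N n : ℕ} (s : ℕ) (hs : s ≤ n) (w : Word N n) : Word N s :=
  fun i => w ⟨i, by omega⟩

/-- `(i_{s+1}, …, i_n)` -/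
def Word.drop {N n : ℕ} (s : ℕ) (w : Word N n) : Word N (n - s) :=
  fun i => w ⟨s + i, by omega⟩

/-- The algebra `M_{N^n}(ℂ)`. -/
abbrev Mat (N n : ℕ) : Type := Matrix (Word N n) (Word N n) ℂ

namespace SelfSimilarMap

variable {K : Type*} [MetricSpace K] {N : ℕ}

/-- `γ_w = γ_{i_n} ∘ ⋯ ∘ γ_{i_1}` for `w = (i_1, …, i_n)`: the members of the family `γ^n`. -/
def wordMap (S : SelfSimilarMap K N) : (n : ℕ) → Word N n → K → K
  | 0, _, y => y
  | n + 1, w, y => S.γ (w (Fin.last n)) (wordMap S n (Fin.init w) y)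

/-- The set `B_γ` of branched points. -/
def branchSet (S : SelfSimilarMap K N) : Set K :=
  {b | ∃ a i j, i ≠ j ∧ b = S.γ i a ∧ b = S.γ j a}

/-- The postcritical set `P_γ`. -/
def postcriticalSet (S : SelfSimilarMap K N) : Set K :=
  {a | ∃ k, 1 ≤ k ∧ ∃ w : Word N k, S.wordMap k w a ∈ S.branchSet}

/-- Assumption B. The map `h` is uniquely determined by `γ`. -/
structure AssumptionB (S : SelfSimilarMap K N) where
  h : K → K
  continuous_h : Continuous h
  h_γ : ∀ j y, h (S.γ j y) = y
  finite_branchSet : S.branchSet.Finite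
  disjoint : S.branchSet ∩ S.postcriticalSet = ∅

/-! ### Words -/

lemma continuous_γ (S : SelfSimilarMap K N) (i : Fin N) : Continuous (S.γ i) := by
  obtain ⟨c', c, h0, h1, h2, h⟩ := S.proper i
  refine LipschitzWith.continuous (K := ⟨c, by linarith⟩) (LipschitzWith.of_dist_le_mul ?_)
  intro x y
  exact (h x y).2

lemma continuous_wordMap (S : SelfSimilarMap K N) (n : ℕ) (w : Word N n) :
    Continuous (S.wordMap n w) := by
  induction n with
  | zero => exact continuous_id
  | succ n ih => exact (S.continuous_γ _).comp (ih _)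

lemma wordMap_split (S : SelfSimilarMap K N) (s r n : ℕ) (e : n = s + r) (w : Word N n) (y : K) :
    S.wordMap n w y = S.wordMap r (fun i => w ⟨s + i, by omega⟩)
      (S.wordMap s (fun i => w ⟨i, by omega⟩) y) := by
  subst e
  induction r with
  | zero => rfl
  | succ r ih =>
    have := ih (Fin.init w)
    change S.γ _ _ = S.γ _ _
    congr 1

lemma wordMap_take_drop (S : SelfSimilarMap K N) {n s : ℕ} (hs : s ≤ n) (w : Word N n) (y : K) :
    S.wordMap n w y = S.wordMap (n - s) (w.drop s) (S.wordMap s (w.take s hs) y) :=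
  S.wordMap_split s (n - s) n (by omega) w y

lemma AssumptionB.iterate_wordMap {S : SelfSimilarMap K N} (b : S.AssumptionB) (n : ℕ)
    (w : Word N n) (y : K) : b.h^[n] (S.wordMap n w y) = y := by
  induction n with
  | zero => rfl
  | succ n ih =>
    rw [Function.iterate_succ_apply]
    change b.h^[n] (b.h (S.γ _ _)) = y
    rw [b.h_γ, ih]

/-- The word with first part `u` and second part `v`. -/
def _root_.Word.join {N n s : ℕ} (u : Word N s) (v : Word N (n - s)) : Word N n :=
  fun i => if h : (i : ℕ) < s then u ⟨i, h⟩ else v ⟨i - s, by omega⟩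

lemma _root_.Word.take_join {N n s : ℕ} (hs : s ≤ n) (u : Word N s) (v : Word N (n - s)) :
    (Word.join u v).take s hs = u := by
  funext i
  simp [Word.take, Word.join]

lemma _root_.Word.drop_join {N n s : ℕ} (u : Word N s) (v : Word N (n - s)) :
    (Word.join u v).drop s = v := by
  funext i
  simp [Word.drop, Word.join]

lemma _root_.Word.join_take_drop {N n s : ℕ} (hs : s ≤ n) (w : Word N n) :
    Word.join (w.take s hs) (w.drop s) = w := by
  funext i
  by_cases h : (i : ℕ) < s
  · simp [Word.join, Word.take, h]
  · have : s + ((i : ℕ) - s) = i := by omega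
    simp [Word.join, Word.drop, h, this]

lemma exists_wordMap (S : SelfSimilarMap K N) (n : ℕ) (x : K) :
    ∃ (w : Word N n) (y : K), S.wordMap n w y = x := by
  induction n generalizing x with
  | zero => exact ⟨fun i => i.elim0, x, rfl⟩
  | succ n ih =>
    have hx : x ∈ ⋃ i, Set.range (S.γ i) := by rw [S.cover]; trivial
    obtain ⟨i, z, rfl⟩ := Set.mem_iUnion.1 hx
    obtain ⟨w, y, rfl⟩ := ih z
    refine ⟨Fin.snoc w i, y, ?_⟩
    simp [wordMap]

/-! ### The correspondences `X_γ^{⊗n}` and the operators on them -/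

/-- The cograph `{(γ_w(y), y)}` of `γ^n`. -/
def cograph (S : SelfSimilarMap K N) (n : ℕ) : Set (K × K) :=
  {z | ∃ w : Word N n, z.1 = S.wordMap n w z.2}

/-- `X_{γ^n} = C(cograph of γ^n)`, which is the `n`-th tensor power `X_γ^{⊗n}` over `A = C(K)`:
see `tensor`, `inner_tensor` and `exists_eq_tensor` below. -/
abbrev X (S : SelfSimilarMap K N) (n : ℕ) : Type _ := C(S.cograph n, ℂ)

/-- The point `(γ_w(y), y)` of the cograph. -/
def pt (S : SelfSimilarMap K N) {n : ℕ} (w : Word N n) (y : K) : S.cograph n :=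
  ⟨(S.wordMap n w y, y), w, rfl⟩

lemma continuous_pt (S : SelfSimilarMap K N) {n : ℕ} (w : Word N n) :
    Continuous (S.pt w) :=
  ((S.continuous_wordMap n w).prodMk continuous_id).subtype_mk _

/-- The left action of `A = C(K)`: `(a · f)(x, y) = a(x) f(x, y)`. -/
def lmul (S : SelfSimilarMap K N) {n : ℕ} (a : C(K, ℂ)) (f : S.X n) : S.X n where
  toFun z := a z.1.1 * f z
  continuous_toFun := by fun_prop

/-- The right action of `A = C(K)`: `(f · a)(x, y) = f(x, y) a(y)`. -/
def rmul (S : SelfSimilarMap K N) {n : ℕ} (f : S.X n) (a : C(K, ℂ)) : S.X n where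
  toFun z := f z * a z.1.2
  continuous_toFun := by fun_prop

/-- The `A`-valued inner product `(f|g)_A(y) = ∑_w conj (f(γ_w(y), y)) g(γ_w(y), y)`. -/
def inner (S : SelfSimilarMap K N) {n : ℕ} (f g : S.X n) : C(K, ℂ) where
  toFun y := ∑ w : Word N n, star (f (S.pt w y)) * g (S.pt w y)
  continuous_toFun := by
    refine continuous_finsetSum _ fun w _ => ?_
    have := S.continuous_pt w
    fun_prop

/-- The Hilbert module norm `‖f‖ = ‖(f|f)_A‖^{1/2}`. -/
def moduleNorm [CompactSpace K] (S : SelfSimilarMap K N) {n : ℕ} (f : S.X n) : ℝ :=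
  Real.sqrt ‖S.inner f f‖

/-- The rank one operator `θ_{x,y}(z) = x (y|z)_A`. -/
def theta (S : SelfSimilarMap K N) {n : ℕ} (x y : S.X n) : S.X n →ₗ[ℂ] S.X n where
  toFun z := S.rmul x (S.inner y z)
  map_add' f g := by
    ext z
    simp [rmul, inner, mul_add, Finset.sum_add_distrib]
  map_smul' c f := by
    ext z
    simp only [rmul, inner, ContinuousMap.coe_mk, ContinuousMap.smul_apply, smul_eq_mul,
      RingHom.id_apply, Finset.mul_sum]
    exact Finset.sum_congr rfl fun w _ => by ring

/-- `𝒦(X_γ^{⊗n})`: the closure, in the operator norm for the Hilbert module norm, of the linear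
span of the rank one operators. -/
def compacts [CompactSpace K] (S : SelfSimilarMap K N) (n : ℕ) : Set (S.X n →ₗ[ℂ] S.X n) :=
  {T | ∀ ε : ℝ, 0 < ε → ∃ F ∈ Submodule.span ℂ {F | ∃ x y : S.X n, F = S.theta x y},
    ∀ f : S.X n, S.moduleNorm (T f - F f) ≤ ε * S.moduleNorm f}

/-- The tensor product `f ⊗ g ∈ X_γ^{⊗n}` of `f ∈ X_γ^{⊗(n-s)}` and `g ∈ X_γ^{⊗s}`:
`(f ⊗ g)(x, y) = f(x, z) g(z, y)`, where `z = h^{n-s}(x)` is the intermediate point. -/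
def AssumptionB.tensor {S : SelfSimilarMap K N} (b : S.AssumptionB) {n : ℕ} (s : ℕ) (hs : s ≤ n)
    (f : S.X (n - s)) (g : S.X s) : S.X n where
  toFun z :=
    f ⟨(z.1.1, b.h^[n - s] z.1.1), by
      obtain ⟨w, hw⟩ := z.2
      refine ⟨w.drop s, ?_⟩
      rw [hw, S.wordMap_take_drop hs, b.iterate_wordMap]⟩ *
    g ⟨(b.h^[n - s] z.1.1, z.1.2), by
      obtain ⟨w, hw⟩ := z.2
      refine ⟨w.take s hs, ?_⟩
      rw [hw, S.wordMap_take_drop hs, b.iterate_wordMap]⟩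
  continuous_toFun := by
    have := b.continuous_h.iterate (n - s)
    fun_prop

lemma AssumptionB.tensor_pt {S : SelfSimilarMap K N} (b : S.AssumptionB) {n : ℕ} (s : ℕ)
    (hs : s ≤ n) (f : S.X (n - s)) (g : S.X s) (w : Word N n) (y : K) :
    b.tensor s hs f g (S.pt w y) =
      f (S.pt (w.drop s) (S.wordMap s (w.take s hs) y)) * g (S.pt (w.take s hs) y) := by
  have hw := S.wordMap_take_drop hs w y
  have h2 : b.h^[n - s] (S.wordMap n w y) = S.wordMap s (w.take s hs) y := by
    rw [hw, b.iterate_wordMap]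
  refine congrArg₂ (· * ·) (congrArg f (Subtype.ext (Prod.ext hw h2)))
    (congrArg g (Subtype.ext ?_))
  exact Prod.ext h2 rfl

lemma sum_word {M : Type*} [AddCommMonoid M] {n s : ℕ} (hs : s ≤ n)
    (F : Word N s → Word N (n - s) → M) :
    ∑ w : Word N n, F (w.take s hs) (w.drop s) = ∑ u, ∑ v, F u v := by
  rw [← Fintype.sum_prod_type']
  refine Finset.sum_bij' (fun w _ => (w.take s hs, w.drop s)) (fun p _ => Word.join p.1 p.2)
    ?_ ?_ ?_ ?_ ?_
  · simp
  · simp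
  · intro w _
    exact Word.join_take_drop hs w
  · intro p _
    exact Prod.ext (Word.take_join hs _ _) (Word.drop_join _ _)
  · simp

/-- The inner product of the interior tensor product:
`(f ⊗ g | f' ⊗ g') = (g | (f|f') · g')`. -/
lemma AssumptionB.inner_tensor {S : SelfSimilarMap K N} (b : S.AssumptionB) {n : ℕ} (s : ℕ)
    (hs : s ≤ n) (f f' : S.X (n - s)) (g g' : S.X s) :
    S.inner (b.tensor s hs f g) (b.tensor s hs f' g') = S.inner g (S.lmul (S.inner f f') g') := by
  ext y
  simp only [inner, ContinuousMap.coe_mk, b.tensor_pt, lmul]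
  rw [sum_word hs (fun u v => star (f (S.pt v (S.wordMap s u y)) * g (S.pt u y)) *
    (f' (S.pt v (S.wordMap s u y)) * g' (S.pt u y)))]
  refine Finset.sum_congr rfl fun u _ => ?_
  rw [Finset.sum_mul, Finset.mul_sum]
  refine Finset.sum_congr rfl fun v _ => ?_
  simp only [pt, star_mul']
  ring

/-- Simple tensors exhaust `X_γ^{⊗n}`. -/
lemma AssumptionB.exists_eq_tensor {S : SelfSimilarMap K N} (b : S.AssumptionB) {n : ℕ} (s : ℕ)
    (hs : s ≤ n) (ξ : S.X n) : ∃ f g, b.tensor s hs f g = ξ := by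
  have key : ∀ z : S.cograph (n - s), (z.1.1, b.h^[s] z.1.2) ∈ S.cograph n := by
    rintro ⟨⟨x, z⟩, v, hv⟩
    obtain ⟨u, y, rfl⟩ := S.exists_wordMap s z
    refine ⟨Word.join u v, ?_⟩
    simp only at hv ⊢
    rw [S.wordMap_take_drop hs, Word.take_join, Word.drop_join, hv, b.iterate_wordMap]
  have hc := b.continuous_h.iterate s
  refine ⟨⟨fun z => ξ ⟨_, key z⟩, by fun_prop⟩, 1, ?_⟩
  ext ⟨⟨x, y⟩, w, hw⟩
  simp only at hw
  subst hw
  have := b.tensor_pt s hs ⟨fun z => ξ ⟨_, key z⟩, by fun_prop⟩ 1 w y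
  refine this.trans ?_
  simp only [pt, ContinuousMap.coe_mk, ContinuousMap.one_apply, mul_one]
  congr 2
  refine Prod.ext (S.wordMap_take_drop hs w y).symm ?_
  exact b.iterate_wordMap _ _ _

/-- `T' = T ⊗ I`, that is, `T'(f ⊗ g) = T f ⊗ g` for `f ∈ X_γ^{⊗(n-s)}` and `g ∈ X_γ^{⊗s}`. -/
def AssumptionB.IsAmpl {S : SelfSimilarMap K N} (b : S.AssumptionB) {n : ℕ} (s : ℕ) (hs : s ≤ n)
    (T : S.X (n - s) →ₗ[ℂ] S.X (n - s)) (T' : S.X n →ₗ[ℂ] S.X n) : Prop :=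
  ∀ f g, T' (b.tensor s hs f g) = b.tensor s hs (T f) g

/-- The finite core `ℱ^(n) = ∑_{s=0}^n 𝒦(X_γ^{⊗(n-s)}) ⊗ I_s`, operators on `X_γ^{⊗n}`. -/
def AssumptionB.core [CompactSpace K] {S : SelfSimilarMap K N} (b : S.AssumptionB) (n : ℕ) :
    Set (S.X n →ₗ[ℂ] S.X n) :=
  {R | ∃ T' : Fin (n + 1) → (S.X n →ₗ[ℂ] S.X n),
    (∀ s : Fin (n + 1), ∃ T ∈ S.compacts (n - s), b.IsAmpl s s.is_le T (T' s)) ∧ R = ∑ s, T' s}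

/-! ### The matrix representation -/

/-- `Z_{γ^n} ⊆ Y_{γ^n} = A^{N^n}`: components with the same branch at `c` agree at `c`. -/
def Z (S : SelfSimilarMap K N) (n : ℕ) : Submodule ℂ (Word N n → C(K, ℂ)) where
  carrier := {f | ∀ (c : K) (w w' : Word N n),
    S.wordMap n w c = S.wordMap n w' c → f w c = f w' c}
  add_mem' {f g} hf hg c w w' h := by simp [hf c w w' h, hg c w w' h]
  zero_mem' := by simp
  smul_mem' a f hf c w w' h := by simp [hf c w w' h]

/-- The isomorphism `φ : X_{γ^n} → Z_{γ^n}`, `φ(ξ)(y) = (ξ(γ_w(y), y))_w`. -/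
def phi (S : SelfSimilarMap K N) {n : ℕ} (ξ : S.X n) : Word N n → C(K, ℂ) :=
  fun w => ⟨fun y => ξ (S.pt w y), ξ.continuous.comp (S.continuous_pt w)⟩

/-- The rank one operator `θ^Y_{x,y} = [x_i conj(y_j)]_{ij}` of `Y_{γ^n} = A^{N^n}`, as a matrix
over `A`, that is, as a matrix valued function on `K`. -/
def thetaY {n : ℕ} (x y : Word N n → C(K, ℂ)) : C(K, Mat N n) where
  toFun p := Matrix.of fun i j => x i p * star (y j p)
  continuous_toFun := by
    refine continuous_matrix fun i j => ?_
    simp only [Matrix.of_apply]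
    fun_prop

/-- `𝒦(Z_{γ^n} ⊆ Y_{γ^n})`: the norm closure of the span of the `θ^Y_{x,y}` with
`x, y ∈ Z_{γ^n}`. (For compact `K` the topology of `C(K, M_{N^n}(ℂ))` is that of the norm.) -/
def compactsZY (S : SelfSimilarMap K N) (n : ℕ) : Submodule ℂ C(K, Mat N n) :=
  (Submodule.span ℂ {M | ∃ x ∈ S.Z n, ∃ y ∈ S.Z n, M = thetaY x y}).topologicalClosure

/-- `M = Ω^(n)(T)` for an operator `T` on `X_γ^{⊗n}`: the element of `𝒦(Z_{γ^n} ⊆ Y_{γ^n})` whose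
restriction to `Z_{γ^n}` is `T` (transported by `φ`). -/
def IsOmega (S : SelfSimilarMap K N) {n : ℕ} (T : S.X n →ₗ[ℂ] S.X n) (M : C(K, Mat N n)) : Prop :=
  M ∈ S.compactsZY n ∧
    ∀ (f : S.X n) (y : K), (M y).mulVec (fun w => S.phi f w y) = fun w => S.phi (T f) w y

/-- `M ⊗ I_s` for `M ∈ M_{N^{n-s}}(A)`: the fiber at `y` is block diagonal, the block indexed by
`u = (i_1, …, i_s)` being `M(γ_{i_s} ∘ ⋯ ∘ γ_{i_1}(y))`. -/
def amplMat (S : SelfSimilarMap K N) {n : ℕ} (s : ℕ) (hs : s ≤ n) (M : C(K, Mat N (n - s))) :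
    C(K, Mat N n) where
  toFun y := Matrix.of fun a b =>
    if a.take s hs = b.take s hs then
      M (S.wordMap s (a.take s hs) y) (a.drop s) (b.drop s) else 0
  continuous_toFun := by
    refine continuous_matrix fun i j => ?_
    simp only [Matrix.of_apply]
    split_ifs
    · exact (M.continuous.comp (S.continuous_wordMap s _)).matrix_elem _ _
    · exact continuous_const

/-- `M = ∑_s Ω^(n-s)(T_s) ⊗ I_s` for some expression `R = ∑_s T_s ⊗ I_s` with
`T_s ∈ 𝒦(X_γ^{⊗(n-s)})`. -/
def AssumptionB.IsPi [CompactSpace K] {S : SelfSimilarMap K N} (b : S.AssumptionB) {n : ℕ}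
    (R : S.X n →ₗ[ℂ] S.X n) (M : C(K, Mat N n)) : Prop :=
  ∃ (T' : Fin (n + 1) → (S.X n →ₗ[ℂ] S.X n)) (M' : Fin (n + 1) → C(K, Mat N n)),
    (∀ s : Fin (n + 1), ∃ T ∈ S.compacts (n - s), ∃ A, S.IsOmega T A ∧
      b.IsAmpl s s.is_le T (T' s) ∧ M' s = S.amplMat s s.is_le A) ∧
    R = ∑ s, T' s ∧ M = ∑ s, M' s

/-! ### The matrix representation is well defined -/

lemma AssumptionB.neBot [CompactSpace K] {S : SelfSimilarMap K N} (b : S.AssumptionB) (x : K) :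
    (nhdsWithin x {x}ᶜ).NeBot := by
  by_contra hx
  rw [Filter.not_neBot, ← isOpen_singleton_iff_punctured_nhds, Metric.isOpen_singleton_iff] at hx
  obtain ⟨ε, hε, hx⟩ := hx
  have hN := S.two_le
  have : Nonempty (Fin N) := ⟨⟨0, by omega⟩⟩
  obtain ⟨c, hc0, hc1, hc⟩ : ∃ c : ℝ, 0 ≤ c ∧ c < 1 ∧
      ∀ i x y, dist (S.γ i x) (S.γ i y) ≤ c * dist x y := by
    choose c' c h0 h1 h2 h using S.proper
    obtain ⟨i, hi⟩ := Finite.exists_max c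
    refine ⟨c i, (h0 i).le.trans (h1 i), h2 i, fun j x y => ((h j x y).2).trans ?_⟩
    exact mul_le_mul_of_nonneg_right (hi j) dist_nonneg
  have hw : ∀ n (w : Word N n) x y,
      dist (S.wordMap n w x) (S.wordMap n w y) ≤ c ^ n * dist x y := by
    intro n
    induction n with
    | zero => intro w x y; simp [wordMap]
    | succ n ih =>
      intro w x y
      refine (hc _ _ _).trans ?_
      rw [pow_succ', mul_assoc]
      exact mul_le_mul_of_nonneg_left (ih _ _ _) hc0
  set D := Metric.diam (Set.univ : Set K) with hD
  have hD0 : 0 ≤ D := Metric.diam_nonneg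
  obtain ⟨n, hn⟩ := exists_pow_lt_of_lt_one (div_pos hε (by linarith : 0 < D + 1)) hc1
  obtain ⟨w, y, hy⟩ := S.exists_wordMap n x
  have hall : ∀ z, z = y := by
    intro z
    have h1 : S.wordMap n w z = x := by
      apply hx
      rw [← hy]
      have h2 : dist z y ≤ D :=
        Metric.dist_le_diam_of_mem isCompact_univ.isBounded trivial trivial
      calc _ ≤ c ^ n * dist z y := hw _ _ _ _
        _ ≤ c ^ n * D := mul_le_mul_of_nonneg_left h2 (pow_nonneg hc0 n)
        _ ≤ c ^ n * (D + 1) := mul_le_mul_of_nonneg_left (by linarith) (pow_nonneg hc0 n)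
        _ < ε := by rwa [lt_div_iff₀ (by linarith)] at hn
    have := congrArg (b.h^[n]) (h1.trans hy.symm)
    rwa [b.iterate_wordMap, b.iterate_wordMap] at this
  have hB : y ∈ S.branchSet :=
    ⟨y, ⟨0, by omega⟩, ⟨1, by omega⟩, by simp, (hall _).symm, (hall _).symm⟩
  have hP : y ∈ S.postcriticalSet := by
    refine ⟨1, le_rfl, fun _ => ⟨0, by omega⟩, ?_⟩
    rw [hall (S.wordMap _ _ _)]
    exact hB
  have : y ∈ S.branchSet ∩ S.postcriticalSet := ⟨hB, hP⟩
  rw [b.disjoint] at this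
  exact this

lemma AssumptionB.exists_of_wordMap_eq {S : SelfSimilarMap K N} (b : S.AssumptionB) (n : ℕ)
    (w w' : Word N n) (y : K) (e : S.wordMap n w y = S.wordMap n w' y) (hne : w ≠ w') :
    ∃ s ≤ n, y ∈ b.h^[s] '' S.branchSet := by
  induction n with
  | zero => exact absurd (Subsingleton.elim w w') hne
  | succ n ih =>
    have e0 : S.γ (w (Fin.last n)) (S.wordMap n (Fin.init w) y) =
      S.γ (w' (Fin.last n)) (S.wordMap n (Fin.init w') y) := e
    have e1 := congrArg b.h e0
    rw [b.h_γ, b.h_γ] at e1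
    by_cases hi : Fin.init w = Fin.init w'
    · refine ⟨n + 1, le_rfl, S.wordMap (n + 1) w y, ?_, b.iterate_wordMap _ _ _⟩
      refine ⟨S.wordMap n (Fin.init w) y, w (Fin.last n), w' (Fin.last n), ?_, rfl, ?_⟩
      · intro hl
        apply hne
        rw [← Fin.snoc_init_self w, ← Fin.snoc_init_self w', hi, hl]
      · rw [e1]
        exact e0
    · obtain ⟨s, hs, h⟩ := ih _ _ e1 hi
      exact ⟨s, by omega, h⟩

lemma AssumptionB.dense_injective [CompactSpace K] {S : SelfSimilarMap K N} (b : S.AssumptionB)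
    (n : ℕ) : Dense {y : K | Function.Injective fun w : Word N n => S.wordMap n w y} := by
  have hfin : (⋃ s ∈ Finset.range (n + 1), b.h^[s] '' S.branchSet).Finite :=
    Set.Finite.biUnion (Finset.finite_toSet _) fun s _ => b.finite_branchSet.image _
  have : ∀ x : K, (nhdsWithin x {x}ᶜ).NeBot := b.neBot
  refine (dense_univ.sdiff_finite hfin).mono ?_
  rintro y ⟨-, hy⟩ w w' e
  by_contra hne
  obtain ⟨s, hs, h⟩ := b.exists_of_wordMap_eq n w w' y e hne
  exact hy (Set.mem_biUnion (by simpa using Nat.lt_succ_of_le hs) h)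

lemma exists_bump (S : SelfSimilarMap K N) {n : ℕ} (w : Word N n) (y : K) :
    ∃ f : S.X n, (∀ z, ‖f z‖ ≤ 1) ∧
      ∀ w', f (S.pt w' y) = if S.wordMap n w' y = S.wordMap n w y then 1 else 0 := by
  set k : ℝ := ∑ w' : Word N n, (dist (S.wordMap n w' y) (S.wordMap n w y))⁻¹ with hk
  have hk0 : 0 ≤ k := Finset.sum_nonneg fun _ _ => inv_nonneg.2 dist_nonneg
  refine ⟨⟨fun z => ((max 0 (1 - k * dist z.1.1 (S.wordMap n w y)) : ℝ) : ℂ), by fun_prop⟩, ?_, ?_⟩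
  · intro z
    simp only [ContinuousMap.coe_mk, Complex.norm_real, Real.norm_eq_abs]
    rw [abs_of_nonneg (le_max_left _ _)]
    refine max_le zero_le_one ?_
    have := mul_nonneg hk0 (dist_nonneg (x := z.1.1) (y := S.wordMap n w y))
    linarith
  · intro w'
    simp only [ContinuousMap.coe_mk, pt]
    split_ifs with h
    · simp [h]
    · have hd : 0 < dist (S.wordMap n w' y) (S.wordMap n w y) := dist_pos.2 h
      have h1 : (dist (S.wordMap n w' y) (S.wordMap n w y))⁻¹ ≤ k :=
        Finset.single_le_sum (f := fun w' : Word N n =>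
          (dist (S.wordMap n w' y) (S.wordMap n w y))⁻¹)
          (fun _ _ => inv_nonneg.2 dist_nonneg) (Finset.mem_univ w')
      have h2 : 1 ≤ k * dist (S.wordMap n w' y) (S.wordMap n w y) := by
        have := mul_le_mul_of_nonneg_right h1 hd.le
        rwa [inv_mul_cancel₀ hd.ne'] at this
      rw [max_eq_left (by linarith)]
      simp

/-- A matrix over `A` is determined by its restriction to `Z_{γ^n} = φ(X_γ^{⊗n})`. -/
lemma AssumptionB.matrix_ext [CompactSpace K] {S : SelfSimilarMap K N} (b : S.AssumptionB) {n : ℕ}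
    (M M' : C(K, Mat N n)) (h : ∀ (f : S.X n) (y : K),
      (M y).mulVec (fun w => S.phi f w y) = (M' y).mulVec (fun w => S.phi f w y)) : M = M' := by
  refine ContinuousMap.ext fun y => congrFun (Continuous.ext_on (b.dense_injective n)
    M.continuous M'.continuous fun y hy => ?_) y
  ext v w
  obtain ⟨f, -, hf⟩ := S.exists_bump w y
  have hphi : (fun w' => S.phi f w' y) = Pi.single w 1 := by
    funext w'
    refine (hf w').trans ?_
    by_cases hw : w' = w
    · simp [hw]
    · rw [if_neg fun e => hw (hy e)]
      simp [hw]
  have := congrFun (h f y) v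
  simpa [hphi] using this

lemma norm_phi_le [CompactSpace K] (S : SelfSimilarMap K N) {n : ℕ} (f : S.X n) (w : Word N n)
    (y : K) : ‖S.phi f w y‖ ≤ S.moduleNorm f := by
  refine Real.le_sqrt_of_sq_le ?_
  refine le_trans ?_ ((S.inner f f).norm_coe_le_norm y)
  have : S.inner f f y = ((∑ w : Word N n, ‖S.phi f w y‖ ^ 2 : ℝ) : ℂ) := by
    simp only [inner, ContinuousMap.coe_mk, phi, Complex.ofReal_sum]
    refine Finset.sum_congr rfl fun w _ => ?_
    rw [Complex.star_def, Complex.conj_mul']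
    simp
  rw [this, Complex.norm_real, Real.norm_of_nonneg (Finset.sum_nonneg fun _ _ => sq_nonneg _)]
  exact Finset.single_le_sum (f := fun w => ‖S.phi f w y‖ ^ 2) (fun _ _ => sq_nonneg _)
    (Finset.mem_univ w)

lemma moduleNorm_le [CompactSpace K] (S : SelfSimilarMap K N) {n : ℕ} (f : S.X n)
    (h : ∀ z, ‖f z‖ ≤ 1) : S.moduleNorm f ≤ Real.sqrt (Fintype.card (Word N n)) := by
  refine Real.sqrt_le_sqrt ?_
  refine (ContinuousMap.norm_le _ (by positivity)).2 fun y => ?_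
  refine (norm_sum_le _ _).trans ?_
  refine (Finset.sum_le_card_nsmul _ _ 1 fun w _ => ?_).trans (by simp)
  rw [norm_mul, norm_star]
  exact mul_le_one₀ (h _) (norm_nonneg _) (h _)

lemma phi_mem_Z (S : SelfSimilarMap K N) {n : ℕ} (f : S.X n) : S.phi f ∈ S.Z n := by
  intro c w w' h
  simp only [phi, ContinuousMap.coe_mk, pt, h]

lemma exists_span (S : SelfSimilarMap K N) {n : ℕ} (F : S.X n →ₗ[ℂ] S.X n)
    (hF : F ∈ Submodule.span ℂ {F | ∃ x y : S.X n, F = S.theta x y}) :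
    ∃ M ∈ Submodule.span ℂ {M | ∃ x ∈ S.Z n, ∃ y ∈ S.Z n, M = thetaY x y},
      (∀ (f : S.X n) (y : K), (M y).mulVec (fun w => S.phi f w y) = fun w => S.phi (F f) w y) ∧
      ∀ y v w w', S.wordMap n w y = S.wordMap n w' y → M y v w = M y v w' := by
  induction hF using Submodule.span_induction with
  | mem F hF =>
    obtain ⟨x, y, rfl⟩ := hF
    refine ⟨_, Submodule.subset_span ⟨S.phi x, S.phi_mem_Z x, S.phi y, S.phi_mem_Z y, rfl⟩, ?_, ?_⟩
    · intro f p
      funext w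
      simp only [Matrix.mulVec, dotProduct, thetaY, ContinuousMap.coe_mk, Matrix.of_apply, phi,
        theta, LinearMap.coe_mk, AddHom.coe_mk, rmul, inner, Finset.mul_sum]
      exact Finset.sum_congr rfl fun _ _ => by rw [mul_assoc]; rfl
    · intro p v w w' h
      simp only [thetaY, ContinuousMap.coe_mk, Matrix.of_apply, S.phi_mem_Z y p w w' h]
  | zero => exact ⟨0, Submodule.zero_mem _, by intro f y; ext w; simp [phi], by simp⟩
  | add F G _ _ ihF ihG =>
    obtain ⟨M, hM, hM1, hM2⟩ := ihF
    obtain ⟨L, hL, hL1, hL2⟩ := ihG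
    refine ⟨M + L, Submodule.add_mem _ hM hL, ?_, ?_⟩
    · intro f y
      rw [ContinuousMap.add_apply, Matrix.add_mulVec, hM1, hL1]
      rfl
    · intro y v w w' h
      simp [hM2 y v w w' h, hL2 y v w w' h]
  | smul c F _ ih =>
    obtain ⟨M, hM, hM1, hM2⟩ := ih
    refine ⟨c • M, Submodule.smul_mem _ c hM, ?_, ?_⟩
    · intro f y
      rw [ContinuousMap.smul_apply, Matrix.smul_mulVec, hM1]
      rfl
    · intro y v w w' h
      simp [hM2 y v w w' h]

lemma exists_isOmega [CompactSpace K] (S : SelfSimilarMap K N) {n : ℕ} (T : S.X n →ₗ[ℂ] S.X n)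
    (hT : T ∈ S.compacts n) : ∃ M, S.IsOmega T M := by
  set C := Real.sqrt (Fintype.card (Word N n)) with hC
  have hpos : ∀ k : ℕ, (0 : ℝ) < (1 / 2) ^ k := fun k => by positivity
  choose F hF hFT using fun k : ℕ => hT _ (hpos k)
  choose M hM hMF hMc using fun k => S.exists_span (F k) (hF k)
  have hTF : ∀ k f w y, ‖S.phi (T f) w y - S.phi (F k f) w y‖ ≤ (1 / 2) ^ k * S.moduleNorm f :=
    fun k f w y => (S.norm_phi_le (T f - F k f) w y).trans (hFT k f)
  have hkl : ∀ k l y v w, ‖M k y v w - M l y v w‖ ≤ ((1 / 2) ^ k + (1 / 2) ^ l) * C := by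
    intro k l y v w
    obtain ⟨f, hf1, hf⟩ := S.exists_bump w y
    set e : ℕ := (Finset.univ.filter fun w' => S.wordMap n w' y = S.wordMap n w y).card with he
    have hMe : ∀ k, S.phi (F k f) v y = e * M k y v w := by
      intro k
      rw [← congrFun (hMF k f y) v]
      simp only [Matrix.mulVec, dotProduct]
      have : ∀ w', M k y v w' * S.phi f w' y =
          if S.wordMap n w' y = S.wordMap n w y then M k y v w else 0 := by
        intro w'
        have h1 : S.phi f w' y = _ := hf w'
        rw [h1]
        split_ifs with h
        · rw [hMc k y v w' w h, mul_one]
        · rw [mul_zero]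
      rw [Finset.sum_congr rfl fun w' _ => this w', ← Finset.sum_filter, Finset.sum_const,
        nsmul_eq_mul]
    have he1 : (1 : ℝ) ≤ e := by
      exact_mod_cast Finset.card_pos.2 ⟨w, by simp⟩
    have h1 : ‖(e : ℂ) * (M k y v w - M l y v w)‖ ≤ ((1 / 2) ^ k + (1 / 2) ^ l) * C := by
      have h2 : (e : ℂ) * (M k y v w - M l y v w) =
          (S.phi (T f) v y - S.phi (F l f) v y) - (S.phi (T f) v y - S.phi (F k f) v y) := by
        rw [hMe, hMe]
        ring
      rw [h2]
      refine (norm_sub_le _ _).trans ?_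
      have hm := S.moduleNorm_le f hf1
      have h3 := (hTF k f v y).trans (mul_le_mul_of_nonneg_left hm (hpos k).le)
      have h4 := (hTF l f v y).trans (mul_le_mul_of_nonneg_left hm (hpos l).le)
      linarith
    rw [norm_mul, Complex.norm_natCast] at h1
    exact (le_mul_of_one_le_left (norm_nonneg _) he1).trans h1
  have hC0 : 0 ≤ C := Real.sqrt_nonneg _
  let m : ℕ → Word N n → Word N n → C(K, ℂ) := fun k v w =>
    ⟨fun y => M k y v w, (M k).continuous.matrix_elem v w⟩
  have hcs : ∀ v w, CauchySeq fun k => m k v w := by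
    intro v w
    refine cauchySeq_of_le_tendsto_0 (fun k : ℕ => 2 * (1 / 2 : ℝ) ^ k * C) ?_ ?_
    · intro k l j hk hl
      refine (ContinuousMap.dist_le (by positivity)).2 fun y => ?_
      rw [dist_eq_norm]
      refine (hkl k l y v w).trans (mul_le_mul_of_nonneg_right ?_ hC0)
      have h1 : (1 / 2 : ℝ) ^ k ≤ (1 / 2) ^ j :=
        pow_le_pow_of_le_one (by norm_num) (by norm_num) hk
      have h2 : (1 / 2 : ℝ) ^ l ≤ (1 / 2) ^ j :=
        pow_le_pow_of_le_one (by norm_num) (by norm_num) hl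
      linarith
    · have := tendsto_pow_atTop_nhds_zero_of_lt_one (r := (1 / 2 : ℝ)) (by norm_num) (by norm_num)
      simpa using (this.const_mul 2).mul_const C
  choose l hl using fun v w => cauchySeq_tendsto_of_complete (hcs v w)
  let E : Word N n → Word N n → C(ℂ, Mat N n) := fun v w =>
    ⟨fun z => Matrix.of fun i j => if v = i ∧ w = j then z else 0, by
      refine continuous_matrix fun i j => ?_
      simp only [Matrix.of_apply]
      split_ifs
      · exact continuous_id
      · exact continuous_const⟩
  have hME : ∀ k, M k = ∑ v, ∑ w, (E v w).comp (m k v w) := by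
    intro k
    ext y i j
    simp [E, m, Matrix.sum_apply, ContinuousMap.sum_apply, ite_and]
  set L : C(K, Mat N n) := ∑ v, ∑ w, (E v w).comp (l v w) with hLdef
  have hL : Filter.Tendsto M Filter.atTop (nhds L) := by
    rw [funext hME]
    refine tendsto_finsetSum _ fun v _ => tendsto_finsetSum _ fun w _ => ?_
    exact ((ContinuousMap.continuous_postcomp (E v w)).tendsto _).comp (hl v w)
  refine ⟨L, mem_closure_of_tendsto hL (Filter.Eventually.of_forall hM), fun f y => ?_⟩
  have h1 : Filter.Tendsto (fun k => (M k y).mulVec (fun w => S.phi f w y)) Filter.atTop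
      (nhds ((L y).mulVec (fun w => S.phi f w y))) := by
    have hy : Filter.Tendsto (fun k => M k y) Filter.atTop (nhds (L y)) :=
      ((continuous_eval_const (F := C(K, Mat N n)) y).tendsto L).comp hL
    have hcm : Continuous fun A : Mat N n => A.mulVec (fun w => S.phi f w y) :=
      continuous_id.matrix_mulVec continuous_const
    exact (hcm.tendsto _).comp hy
  have h2 : Filter.Tendsto (fun k => (M k y).mulVec (fun w => S.phi f w y)) Filter.atTop
      (nhds (fun w => S.phi (T f) w y)) := by
    rw [tendsto_pi_nhds]
    intro w
    rw [tendsto_iff_norm_sub_tendsto_zero]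
    have h3 := (tendsto_pow_atTop_nhds_zero_of_lt_one (r := (1 / 2 : ℝ)) (by norm_num)
      (by norm_num)).mul_const (S.moduleNorm f)
    rw [zero_mul] at h3
    refine squeeze_zero (fun _ => norm_nonneg _) (fun k => ?_) h3
    rw [hMF, norm_sub_rev]
    exact hTF k f w y
  exact tendsto_nhds_unique h1 h2

lemma AssumptionB.amplMat_mulVec {S : SelfSimilarMap K N} (b : S.AssumptionB) {n s : ℕ}
    (hs : s ≤ n) {T : S.X (n - s) →ₗ[ℂ] S.X (n - s)} {A : C(K, Mat N (n - s))}
    {T' : S.X n →ₗ[ℂ] S.X n} (hA : S.IsOmega T A) (hT : b.IsAmpl s hs T T') (ξ : S.X n) (y : K) :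
    (S.amplMat s hs A y).mulVec (fun w => S.phi ξ w y) = fun w => S.phi (T' ξ) w y := by
  obtain ⟨f, g, rfl⟩ := b.exists_eq_tensor s hs ξ
  have hphi : ∀ (f : S.X (n - s)) w, S.phi (b.tensor s hs f g) w y =
      S.phi f (w.drop s) (S.wordMap s (w.take s hs) y) * S.phi g (w.take s hs) y :=
    fun f w => b.tensor_pt s hs f g w y
  funext w
  rw [hT, hphi]
  have h1 := congrFun (hA.2 f (S.wordMap s (w.take s hs) y)) (w.drop s)
  refine Eq.trans ?_ (congrArg (· * S.phi g (w.take s hs) y) h1)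
  simp only [Matrix.mulVec, dotProduct, amplMat, ContinuousMap.coe_mk, Matrix.of_apply, hphi]
  rw [sum_word hs (fun u v => (if w.take s hs = u then
      A (S.wordMap s (w.take s hs) y) (w.drop s) v else 0) *
      (S.phi f v (S.wordMap s u y) * S.phi g u y)), Finset.sum_eq_single (w.take s hs)]
  · simp [Finset.sum_mul, mul_assoc]
  · intro u _ hu
    simp [Ne.symm hu]
  · simp

theorem AssumptionB.existsUnique_isPi [CompactSpace K] {S : SelfSimilarMap K N}
    (b : S.AssumptionB) {n : ℕ} (R : b.core n) : ∃! M : C(K, Mat N n), b.IsPi R.1 M := by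
  obtain ⟨R, hcore⟩ := R
  obtain ⟨T', h, hR⟩ := id hcore
  have huniq : ∀ M, b.IsPi R M → ∀ (ξ : S.X n) (y : K),
      (M y).mulVec (fun w => S.phi ξ w y) = fun w => S.phi (R ξ) w y := by
    rintro M ⟨T', M', h, hR, rfl⟩ ξ y
    have h1 : (∑ s, M' s) y = ∑ s, M' s y := by simp
    have h2 : (fun w => S.phi (R ξ) w y) = ∑ s, fun w => S.phi (T' s ξ) w y := by
      funext w
      simp [hR, phi]
    rw [h1, h2, Matrix.sum_mulVec]
    refine Finset.sum_congr rfl fun s _ => ?_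
    obtain ⟨T, -, A, hA, hT, hM⟩ := h s
    rw [hM, b.amplMat_mulVec _ hA hT]
  choose T hT hTT' using h
  choose A hA using fun s => S.exists_isOmega (T s) (hT s)
  have hex : b.IsPi R (∑ s : Fin (n + 1), S.amplMat s s.is_le (A s)) :=
    ⟨T', fun s => S.amplMat s s.is_le (A s),
      fun s => ⟨T s, hT s, A s, hA s, hTT' s, rfl⟩, hR, rfl⟩
  exact ⟨_, hex, fun M hM => b.matrix_ext _ _ fun f y =>
    (huniq _ hM f y).trans (huniq _ hex f y).symm⟩

/-- The matrix representation `Π^(n) : ℱ^(n) → M_{N^n}(A)`,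
`Π^(n)(∑_s T_s ⊗ I_s) = ∑_s Ω^(n-s)(T_s) ⊗ I_s`. -/
def AssumptionB.piMap [CompactSpace K] {S : SelfSimilarMap K N} (b : S.AssumptionB) {n : ℕ}
    (R : b.core n) : C(K, Mat N n) :=
  (b.existsUnique_isPi R).choose

lemma compacts_rmul [CompactSpace K] (S : SelfSimilarMap K N) {n : ℕ} (T : S.X n →ₗ[ℂ] S.X n)
    (hT : T ∈ S.compacts n) (f : S.X n) (a : C(K, ℂ)) : T (S.rmul f a) = S.rmul (T f) a := by
  have hF : ∀ F ∈ Submodule.span ℂ {F | ∃ x y : S.X n, F = S.theta x y},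
      F (S.rmul f a) = S.rmul (F f) a := by
    intro F hF
    induction hF using Submodule.span_induction with
    | mem F hF =>
      obtain ⟨x, y, rfl⟩ := hF
      ext z
      simp only [theta, rmul, inner, LinearMap.coe_mk, AddHom.coe_mk, ContinuousMap.coe_mk]
      rw [mul_assoc, Finset.sum_mul]
      refine congrArg _ (Finset.sum_congr rfl fun w _ => ?_)
      rw [mul_assoc]
      rfl
    | zero => ext z; simp [rmul]
    | add F G _ _ ihF ihG =>
      rw [LinearMap.add_apply, ihF, ihG]
      ext z
      simp [rmul, add_mul]
    | smul c F _ ih =>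
      rw [LinearMap.smul_apply, ih]
      ext z
      simp [rmul, mul_assoc]
  ext ⟨⟨x, y⟩, w, hw⟩
  simp only at hw
  subst hw
  set D := S.moduleNorm (S.rmul f a) + S.moduleNorm f * ‖a y‖ with hD
  have hD0 : 0 ≤ D :=
    add_nonneg (Real.sqrt_nonneg _) (mul_nonneg (Real.sqrt_nonneg _) (norm_nonneg _))
  have key : ∀ ε : ℝ, 0 < ε →
      ‖S.phi (T (S.rmul f a)) w y - S.phi (T f) w y * a y‖ ≤ ε * D := by
    intro ε hε
    obtain ⟨F, hFs, hFT⟩ := hT ε hε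
    have h1 := (S.norm_phi_le _ w y).trans (hFT (S.rmul f a))
    have h2 := (S.norm_phi_le _ w y).trans (hFT f)
    have e : S.phi (T (S.rmul f a)) w y - S.phi (T f) w y * a y =
        S.phi (T (S.rmul f a) - F (S.rmul f a)) w y - S.phi (T f - F f) w y * a y := by
      rw [hF F hFs]
      simp only [phi, rmul, pt, ContinuousMap.coe_mk, ContinuousMap.sub_apply]
      ring
    rw [e]
    refine (norm_sub_le _ _).trans ?_
    rw [norm_mul]
    have h3 := mul_le_mul_of_nonneg_right h2 (norm_nonneg (a y))
    rw [hD]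
    linarith
  have h0 : ‖S.phi (T (S.rmul f a)) w y - S.phi (T f) w y * a y‖ ≤ 0 := by
    refine le_of_forall_pos_le_add fun ε hε => ?_
    have := key (ε / (D + 1)) (by positivity)
    refine this.trans ?_
    rw [zero_add, div_mul_eq_mul_div, div_le_iff₀ (by linarith)]
    nlinarith
  exact sub_eq_zero.1 (norm_le_zero_iff.1 h0)

lemma AssumptionB.compacts_subset_core [CompactSpace K] {S : SelfSimilarMap K N}
    (b : S.AssumptionB) (n : ℕ) : S.compacts n ⊆ b.core n := by
  intro T hT
  have hten : ∀ (f : S.X (n - 0)) (g : S.X 0), b.tensor 0 (Nat.zero_le n) f g =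
      S.rmul (n := n) f ⟨fun y => g (S.pt Fin.elim0 y),
        g.continuous.comp (S.continuous_pt (n := 0) _)⟩ := by
    rintro f g
    ext ⟨⟨x, y⟩, w, hw⟩
    simp only at hw
    subst hw
    refine (b.tensor_pt 0 (Nat.zero_le n) f g w y).trans ?_
    refine congrArg₂ (· * ·) (congrArg f (Subtype.ext (Prod.ext ?_ rfl)))
      (congrArg g (Subtype.ext rfl))
    exact (S.wordMap_take_drop (Nat.zero_le n) w y).symm
  have hampl : b.IsAmpl 0 (Nat.zero_le n) T T := by
    intro f g
    rw [hten, hten]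
    exact S.compacts_rmul T hT f _
  refine ⟨Fin.cons T 0, fun s => ?_, by simp [Fin.sum_univ_succ]⟩
  refine Fin.cases ?_ (fun s => ?_) s
  · exact ⟨T, hT, hampl⟩
  · refine ⟨0, fun ε hε => ⟨0, Submodule.zero_mem _, fun f => ?_⟩, fun f g => ?_⟩
    · have : S.moduleNorm (0 : S.X (n - s.succ)) = 0 := by
        have : S.inner (0 : S.X (n - s.succ)) 0 = 0 := by ext; simp [inner]
        simp [moduleNorm, this]
      simp only [LinearMap.zero_apply, sub_zero, this]
      exact mul_nonneg hε.le (Real.sqrt_nonneg _)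
    · ext z
      simp [AssumptionB.tensor]

/-- The fiber `Π^(n)(𝒜)(P)` of the image of a set `𝒜 ⊆ ℱ^(n)`. -/
def AssumptionB.fiber [CompactSpace K] {S : SelfSimilarMap K N} (b : S.AssumptionB) {n : ℕ}
    (𝒜 : Set (S.X n →ₗ[ℂ] S.X n)) (P : K) : Set (Mat N n) :=
  {M | ∃ T : b.core n, T.1 ∈ 𝒜 ∧ b.piMap T P = M}

/-! ### The building blocks of the fibers -/

/-- The subspace `Z_{γ^n}(P) = {(f_w(P))_w | f ∈ Z_{γ^n}}` of `ℂ^{N^n}`. -/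
def ZFiber (S : SelfSimilarMap K N) (n : ℕ) (P : K) :
    Submodule ℂ (EuclideanSpace ℂ (Word N n)) where
  carrier := {v | ∃ f ∈ S.Z n, ∀ w, v w = f w P}
  add_mem' := by
    rintro u v ⟨f, hf, hu⟩ ⟨g, hg, hv⟩
    exact ⟨f + g, Submodule.add_mem _ hf hg, fun w => by simp [hu, hv]⟩
  zero_mem' := ⟨0, Submodule.zero_mem _, by simp⟩
  smul_mem' := by
    rintro c u ⟨f, hf, hu⟩
    exact ⟨c • f, Submodule.smul_mem _ c hf, fun w => by simp [hu]⟩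

/-- The matrix `Q_{γ^n}(P)` of the orthogonal projection of `ℂ^{N^n}` onto `Z_{γ^n}(P)`. -/
def Q (S : SelfSimilarMap K N) (n : ℕ) (P : K) : Mat N n :=
  (Matrix.toEuclideanCLM (n := Word N n) (𝕜 := ℂ)).symm (S.ZFiber n P).starProjection

/-- `π_{q,u}(A)` for `A ∈ M_{N^q}(ℂ)`, `q = n - p`: the block diagonal matrix whose diagonal block
indexed by `u = (i_1, …, i_p)` is `A` and whose other blocks are `0`. -/
def blockMat {n p : ℕ} (hp : p ≤ n) (u : Word N p) (A : Mat N (n - p)) : Mat N n :=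
  Matrix.of fun a c =>
    if a.take p hp = u ∧ c.take p hp = u then A (a.drop p) (c.drop p) else 0

/-- `C̃(P, R, p)`, for `h^p(R) = P`: the matrices `∑_u π_{q,u}(A)`, where `u = (i_1, …, i_p)` runs
through the words that lead from `P` to `R`, that is, `γ_{i_p} ∘ ⋯ ∘ γ_{i_1}(P) = R`.
If `R` is a branched point these are the words `(i_1, …, i_{p-1}, j(R, l))` with
`γ_{i_{p-1}} ∘ ⋯ ∘ γ_{i_1}(P) = h(R)` and `γ_{j(R, l)}(h(R)) = R`. -/
def CTilde (S : SelfSimilarMap K N) {n : ℕ} (P R : K) (p : ℕ) (hp : p ≤ n) : Set (Mat N n) :=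
  {T | ∃ A : Mat N (n - p), T = ∑ u : Word N p with S.wordMap p u P = R, blockMat hp u A}

/-- `C(P, R, p) = (I - Q_{γ^n}(P)) C̃(P, R, p)` -/
def CBlock (S : SelfSimilarMap K N) {n : ℕ} (P R : K) (p : ℕ) (hp : p ≤ n) : Set (Mat N n) :=
  {T | ∃ T' ∈ S.CTilde P R p hp, T = (1 - S.Q n P) * T'}

/-- The pairs `(p, R)` with `1 ≤ p ≤ n`, `R ∈ B_γ` and `h^p(R) = P`. -/
def AssumptionB.Index {S : SelfSimilarMap K N} (b : S.AssumptionB) (n : ℕ) (P : K) : Type _ :=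
  {x : ℕ × K // 1 ≤ x.1 ∧ x.1 ≤ n ∧ x.2 ∈ S.branchSet ∧ b.h^[x.1] x.2 = P}

instance {S : SelfSimilarMap K N} (b : S.AssumptionB) (n : ℕ) (P : K) : Finite (b.Index n P) :=
  (((Set.finite_Iic n).prod b.finite_branchSet).subset (s := {_x : ℕ × K | _})
    fun _ hx => ⟨hx.2.1, hx.2.2.1⟩).to_subtype

instance {S : SelfSimilarMap K N} (b : S.AssumptionB) (n : ℕ) (P : K) : Fintype (b.Index n P) :=
  Fintype.ofFinite _

end SelfSimilarMap

end

noncomputable section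

/-! ### Words -/

/-! Read a word as a path that starts at P and visits one point after each letter. Matrices whose
entries depend only on the endpoints of their row and column words form the corner Q M Q of the full
matrix algebra M, and by interpolation this corner is exactly the fiber of the compact operators
(`mem_fiber_compacts`). The fiber of the core consists of the sums of amplifications of such
matrices, with values free to choose at the finitely many points reached from P (`mem_fiber_core`).

Because no branched point is postcritical, a path meets B_γ at most once, and after meeting it the
endpoint determines the remaining letters. Since h recovers every intermediate point from the
endpoint, two distinct words with the same endpoint differ in a single letter, and the point reached
just after that letter is branched (`exists_branch_time`). Hence the matrices ∑_u π_{n-p,u}(A)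
commute with Q (`commute_branchMat`), and those belonging to different pairs (p, R) multiply to
zero. Compression by I - Q is still faithful on each of them, because at least two words lead from P
to R (`branchHom_injective`). The summands are therefore mutually orthogonal *-algebras, all
orthogonal to the corner, and the sum is direct.

To see that they exhaust the core, take an amplification T = B ⊗ I_s and subtract, for each (p, R)
with p ≤ s, the branch matrix built from a diagonal block of T at a word from P to R. What remains
has columns in the range of Q (`colInv_ampl_sub`), so (I - Q)T is a sum of elements of the C(P, R,
p). The adjoint gives the same sum for T(I - Q). Thus T commutes with Q, and T is QTQ plus that sum.
-/

lemma Word.join_apply_of_lt {N n s : ℕ} (u : Word N s) (v : Word N (n - s)) {j : Fin n}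
    (h : (j : ℕ) < s) : Word.join u v j = u ⟨j, h⟩ := by
  simp [Word.join, h]

lemma Word.join_drop_apply {N n s : ℕ} (u : Word N s) (d : Word N n) {j : Fin n}
    (h : s ≤ (j : ℕ)) : Word.join u (d.drop s) j = d j := by
  have : s + ((j : ℕ) - s) = j := by omega
  simp [Word.join, Word.drop, not_lt.2 h, this]

lemma Word.drop_join_drop {N n p s : ℕ} (h : p ≤ s) (u : Word N p) (d : Word N n) :
    (Word.join u (d.drop p)).drop s = d.drop s := by
  funext i
  exact Word.join_drop_apply u d (by simp only; omega)

/-- Overwriting the first p letters by a fixed u leaves only the letters after p to compare. This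
allows blocks of an amplification at different prefixes to be compared. -/
lemma Word.take_eq_iff_of_le {N n p s : ℕ} (h : p ≤ s) (hs : s ≤ n) (u : Word N p)
    (d c : Word N n) : d.take s hs = c.take s hs ↔ d.take p (h.trans hs) = c.take p (h.trans hs) ∧
      (Word.join u (d.drop p)).take s hs = (Word.join u (c.drop p)).take s hs := by
  constructor
  · intro e
    refine ⟨funext fun j => congrFun e ⟨j, j.2.trans_le h⟩, funext fun j => ?_⟩
    by_cases hj : (j : ℕ) < p
    · exact (Word.join_apply_of_lt u (d.drop p) (j := ⟨j, by omega⟩) hj).trans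
        (Word.join_apply_of_lt u (c.drop p) (j := ⟨j, by omega⟩) hj).symm
    · exact (Word.join_drop_apply u d (j := ⟨j, by omega⟩) (not_lt.1 hj)).trans
        ((congrFun e j).trans
          (Word.join_drop_apply u c (j := ⟨j, by omega⟩) (not_lt.1 hj)).symm)
  · rintro ⟨e1, e2⟩
    funext j
    by_cases hj : (j : ℕ) < p
    · exact congrFun e1 ⟨j, hj⟩
    · exact (Word.join_drop_apply u d (j := ⟨j, by omega⟩) (not_lt.1 hj)).symm.trans
        ((congrFun e2 j).trans
          (Word.join_drop_apply u c (j := ⟨j, by omega⟩) (not_lt.1 hj)))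

namespace SelfSimilarMap

variable {K : Type*} [MetricSpace K] {N : ℕ}

/-! ### Invariant matrices and interpolation -/

/-- The entries of `M` depend only on the endpoints `γ_v(y)` and `γ_w(y)` of the words that index
its rows and columns. -/
def IsInv (S : SelfSimilarMap K N) (n : ℕ) (y : K) (M : Mat N n) : Prop :=
  ∀ v v' w w', S.wordMap n v y = S.wordMap n v' y → S.wordMap n w y = S.wordMap n w' y →
    M v w = M v' w'

/-- The data live on a finite, hence closed and discrete, subset of the cograph, so the Tietze
theorem extends them. Consistency on equal endpoints makes them a function there. -/
lemma exists_X_eq (S : SelfSimilarMap K N) {n : ℕ} {F : Set K} (hF : F.Finite)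
    (v : K → Word N n → ℂ)
    (hv : ∀ y w w', S.wordMap n w y = S.wordMap n w' y → v y w = v y w') :
    ∃ f : S.X n, ∀ y ∈ F, ∀ w, f (S.pt w y) = v y w := by
  set t : Set (S.cograph n) := ⋃ w : Word N n, S.pt w '' F with ht
  have htf : t.Finite := Set.finite_iUnion fun w => hF.image _
  have : Finite t := htf
  have : DiscreteTopology t := Finite.instDiscreteTopology
  let g : C(t, ℂ) := ⟨fun z => v z.1.1.2 z.1.2.choose, continuous_of_discreteTopology⟩
  obtain ⟨f, hf⟩ := ContinuousMap.exists_restrict_eq htf.isClosed g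
  refine ⟨f, fun y hy w => ?_⟩
  have hm : S.pt w y ∈ t := Set.mem_iUnion.2 ⟨w, y, hy, rfl⟩
  refine (DFunLike.congr_fun hf ⟨S.pt w y, hm⟩).trans ?_
  exact hv y _ _ (S.pt w y).2.choose_spec.symm

lemma isOmega_sum_theta (S : SelfSimilarMap K N) {n : ℕ} {ι : Type*} (s : Finset ι)
    (f g : ι → S.X n) :
    S.IsOmega (∑ i ∈ s, S.theta (f i) (g i)) (∑ i ∈ s, thetaY (S.phi (f i)) (S.phi (g i))) := by
  refine ⟨Submodule.sum_mem _ fun i _ => subset_closure (Submodule.subset_span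
    ⟨_, S.phi_mem_Z _, _, S.phi_mem_Z _, rfl⟩), fun ξ y => ?_⟩
  rw [ContinuousMap.sum_apply, Matrix.sum_mulVec]
  funext w
  simp only [Finset.sum_apply, LinearMap.sum_apply, phi, ContinuousMap.coe_mk,
    ContinuousMap.sum_apply]
  refine Finset.sum_congr rfl fun i _ => ?_
  simp only [Matrix.mulVec, dotProduct, thetaY, ContinuousMap.coe_mk, Matrix.of_apply,
    theta, LinearMap.coe_mk, AddHom.coe_mk, rmul, inner, Finset.mul_sum]
  exact Finset.sum_congr rfl fun _ _ => by rw [mul_assoc]; rfl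

lemma span_theta_subset_compacts [CompactSpace K] (S : SelfSimilarMap K N) {n : ℕ}
    {T : S.X n →ₗ[ℂ] S.X n} (hT : T ∈ Submodule.span ℂ {F | ∃ x y : S.X n, F = S.theta x y}) :
    T ∈ S.compacts n := by
  intro ε hε
  refine ⟨T, hT, fun f => ?_⟩
  have h0 : S.moduleNorm (0 : S.X n) = 0 := by
    have : S.inner (0 : S.X n) 0 = 0 := by ext; simp [inner]
    simp [moduleNorm, this]
  rw [sub_self, h0]
  exact mul_nonneg hε.le (Real.sqrt_nonneg _)

/-- An invariant matrix is the sum over w' of its column w' times the indicator of the endpoint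
class of w'. Each class is counted once per member, hence the division by its size `e`.
Interpolating both factors yields a finite rank operator. -/
lemma exists_compacts_eq [CompactSpace K] (S : SelfSimilarMap K N) {n : ℕ} {F : Set K}
    (hF : F.Finite) (B : K → Mat N n) (hB : ∀ y, S.IsInv n y (B y)) :
    ∃ T ∈ S.compacts n, ∃ A, S.IsOmega T A ∧ ∀ y ∈ F, A y = B y := by
  let e : K → Word N n → ℕ := fun y w =>
    (Finset.univ.filter fun w' => S.wordMap n w y = S.wordMap n w' y).card
  have he : ∀ y w, (e y w : ℂ) ≠ 0 := fun y w =>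
    Nat.cast_ne_zero.2 (Finset.card_pos.2 ⟨w, by simp⟩).ne'
  choose f hf using fun w' => S.exists_X_eq hF (fun y v => B y v w' / e y w')
    (fun y v v' h => by simp only [hB y v v' w' w' h rfl])
  choose g hg using fun w' => S.exists_X_eq (n := n) hF
    (fun y v => if S.wordMap n v y = S.wordMap n w' y then (1 : ℂ) else 0)
    (fun y v v' h => by simp only [h])
  refine ⟨∑ w', S.theta (f w') (g w'), S.span_theta_subset_compacts (Submodule.sum_mem _
    fun i _ => Submodule.subset_span ⟨_, _, rfl⟩), _, S.isOmega_sum_theta _ f g, fun y hy => ?_⟩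
  ext v w
  rw [ContinuousMap.sum_apply, Matrix.sum_apply]
  have : ∀ w', thetaY (S.phi (f w')) (S.phi (g w')) y v w =
      if S.wordMap n w y = S.wordMap n w' y then B y v w / e y w else 0 := by
    intro w'
    simp only [thetaY, phi, ContinuousMap.coe_mk, Matrix.of_apply, hf w' y hy, hg w' y hy]
    split_ifs with h
    · simp only [star_one, mul_one, hB y v v w w' rfl h, e, h]
    · simp
  rw [Finset.sum_congr rfl fun w' _ => this w', ← Finset.sum_filter, Finset.sum_const,
    nsmul_eq_mul]
  exact mul_div_cancel₀ _ (he y w)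

/-- Equality of two entries at y is a closed linear condition, and rank one matrices built from `Z`
satisfy it. -/
lemma isInv_of_mem_compactsZY (S : SelfSimilarMap K N) {n : ℕ} {A : C(K, Mat N n)}
    (hA : A ∈ S.compactsZY n) (y : K) : S.IsInv n y (A y) := by
  intro v v' w w' h h'
  have hc : ∀ v w, Continuous fun A : C(K, Mat N n) => A y v w := fun v w =>
    (continuous_eval_const (F := C(K, Mat N n)) y).matrix_elem v w
  have hcl : IsClosed {A : C(K, Mat N n) | A y v w = A y v' w'} :=
    isClosed_eq (hc v w) (hc v' w')
  refine closure_minimal ?_ hcl hA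
  intro M hM
  induction hM using Submodule.span_induction with
  | mem M hM =>
    obtain ⟨f, hf, g, hg, rfl⟩ := hM
    simp [thetaY, hf y v v' h, hg y w w' h']
  | zero => simp
  | add F G _ _ ihF ihG =>
    simp only [Set.mem_ofPred_eq] at ihF ihG
    simp [ihF, ihG]
  | smul c F _ ih =>
    simp only [Set.mem_ofPred_eq] at ih
    simp [ih]

/-! ### Amplification -/

/-- The coefficient function `(x, z) ↦ ξ(x, h^s(z))`, for which `ξ = f ⊗ 1`. -/
def AssumptionB.untensor {S : SelfSimilarMap K N} (b : S.AssumptionB) {n : ℕ} (s : ℕ)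
    (hs : s ≤ n) : S.X n →ₗ[ℂ] S.X (n - s) where
  toFun ξ :=
    ⟨fun z => ξ ⟨(z.1.1, b.h^[s] z.1.2), by
      obtain ⟨⟨x, z⟩, v, hv⟩ := z
      obtain ⟨u, y, rfl⟩ := S.exists_wordMap s z
      refine ⟨Word.join u v, ?_⟩
      simp only at hv ⊢
      rw [S.wordMap_take_drop hs, Word.take_join, Word.drop_join, hv, b.iterate_wordMap]⟩, by
      have := b.continuous_h.iterate s
      fun_prop⟩
  map_add' _ _ := rfl
  map_smul' _ _ := rfl

/-- Every ξ is `untensor ξ` ⊗ 1, which forces T'ξ = T(`untensor ξ`) ⊗ 1. Right A-linearity of T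
makes this formula compatible with all simple tensors. -/
lemma AssumptionB.exists_isAmpl [CompactSpace K] {S : SelfSimilarMap K N} (b : S.AssumptionB)
    {n s : ℕ} (hs : s ≤ n) {T : S.X (n - s) →ₗ[ℂ] S.X (n - s)} (hT : T ∈ S.compacts (n - s)) :
    ∃ T', b.IsAmpl s hs T T' := by
  let L : S.X (n - s) →ₗ[ℂ] S.X n :=
    { toFun := fun f => b.tensor s hs f 1
      map_add' := fun f g => by ext z; simp [tensor]
      map_smul' := fun c f => by ext z; simp [tensor] }
  refine ⟨L ∘ₗ T ∘ₗ b.untensor s hs, fun f g => ?_⟩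
  -- Since z determines its starting point h^s(z), g is a function of z alone and f ⊗ g = (f · a) ⊗
  -- 1.
  let a : C(K, ℂ) := ⟨fun z => g ⟨(z, b.h^[s] z), by
    obtain ⟨u, y, rfl⟩ := S.exists_wordMap s z
    exact ⟨u, by simp only [b.iterate_wordMap]⟩⟩, by
      have := b.continuous_h.iterate s
      fun_prop⟩
  have h1 : b.untensor s hs (b.tensor s hs f g) = S.rmul f a := by
    ext ⟨⟨x, z⟩, v, hv⟩
    simp only at hv
    subst hv
    obtain ⟨u, y, rfl⟩ := S.exists_wordMap s z
    simp only [untensor, tensor, rmul, LinearMap.coe_mk, AddHom.coe_mk, ContinuousMap.coe_mk, a,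
      b.iterate_wordMap]
  rw [LinearMap.comp_apply, LinearMap.comp_apply, h1, S.compacts_rmul T hT]
  ext ⟨⟨x, y⟩, w, hw⟩
  simp only at hw
  subst hw
  refine (b.tensor_pt s hs _ 1 w y).trans (Eq.trans ?_ (b.tensor_pt s hs (T f) g w y).symm)
  simp only [rmul, ContinuousMap.coe_mk, ContinuousMap.one_apply, mul_one, a, pt,
    b.iterate_wordMap]

/-- The value at `y` of `B ⊗ I_s`, for a matrix valued function `B`. -/
def ampl (S : SelfSimilarMap K N) {n : ℕ} (s : ℕ) (hs : s ≤ n) (y : K)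
    (B : K → Mat N (n - s)) : Mat N n :=
  Matrix.of fun a c =>
    if a.take s hs = c.take s hs then
      B (S.wordMap s (a.take s hs) y) (a.drop s) (c.drop s) else 0

/-! ### The fibers of the finite core and of the compact operators -/

lemma AssumptionB.isPi_mulVec [CompactSpace K] {S : SelfSimilarMap K N} (b : S.AssumptionB)
    {n : ℕ} {R : S.X n →ₗ[ℂ] S.X n} {M : C(K, Mat N n)} (hM : b.IsPi R M) (ξ : S.X n) (y : K) :
    (M y).mulVec (fun w => S.phi ξ w y) = fun w => S.phi (R ξ) w y := by
  obtain ⟨T', M', h, hR, rfl⟩ := hM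
  have h2 : (fun w => S.phi (R ξ) w y) = ∑ s, fun w => S.phi (T' s ξ) w y := by
    funext w
    simp [hR, phi]
  rw [ContinuousMap.sum_apply, h2, Matrix.sum_mulVec]
  refine Finset.sum_congr rfl fun s _ => ?_
  obtain ⟨T, -, A, hA, hT, hM⟩ := h s
  rw [hM, b.amplMat_mulVec _ hA hT]

lemma AssumptionB.isPi_piMap [CompactSpace K] {S : SelfSimilarMap K N} (b : S.AssumptionB)
    {n : ℕ} (R : b.core n) : b.IsPi R.1 (b.piMap R) :=
  (b.existsUnique_isPi R).choose_spec.1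

/-- Both matrices act on the image of `phi` as the operator does, and `matrix_ext` says that this
action determines a matrix over A. -/
lemma AssumptionB.piMap_eq_of_isOmega [CompactSpace K] {S : SelfSimilarMap K N}
    (b : S.AssumptionB) {n : ℕ} (R : b.core n) {A : C(K, Mat N n)} (hA : S.IsOmega R.1 A) :
    b.piMap R = A :=
  b.matrix_ext _ _ fun f y => (b.isPi_mulVec (b.isPi_piMap R) f y).trans (hA.2 f y).symm

theorem AssumptionB.mem_fiber_compacts [CompactSpace K] {S : SelfSimilarMap K N}
    (b : S.AssumptionB) {n : ℕ} {P : K} {M : Mat N n} :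
    M ∈ b.fiber (S.compacts n) P ↔ S.IsInv n P M := by
  constructor
  · rintro ⟨T, hT, rfl⟩
    obtain ⟨A, hA⟩ := S.exists_isOmega T.1 hT
    rw [b.piMap_eq_of_isOmega T hA]
    exact S.isInv_of_mem_compactsZY hA.1 P
  · intro hM
    obtain ⟨T, hT, A, hA, hAB⟩ := S.exists_compacts_eq (Set.finite_singleton P)
      (Pi.single P M) (fun y => by
        by_cases h : y = P
        · subst h; simpa using hM
        · simp [Pi.single_eq_of_ne h, IsInv])
    refine ⟨⟨T, b.compacts_subset_core n hT⟩, hT, ?_⟩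
    rw [b.piMap_eq_of_isOmega ⟨T, b.compacts_subset_core n hT⟩ hA, hAB P rfl, Pi.single_eq_same]

/-- The fiber at P sees the coefficient of I_s only at the finitely many points γ_u(P), where
interpolation realizes any invariant values. Continuity of B in y can therefore be dropped. -/
theorem AssumptionB.mem_fiber_core [CompactSpace K] {S : SelfSimilarMap K N}
    (b : S.AssumptionB) {n : ℕ} {P : K} {M : Mat N n} :
    M ∈ b.fiber (b.core n) P ↔ ∃ B : (s : Fin (n + 1)) → K → Mat N (n - s),
      (∀ (s : Fin (n + 1)) y, S.IsInv (n - s) y (B s y)) ∧ M = ∑ s : Fin (n + 1), S.ampl (s : ℕ) s.is_le P (B s) := by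
  constructor
  · rintro ⟨R, -, rfl⟩
    obtain ⟨T', M', h, hR, hM⟩ := b.isPi_piMap R
    choose T hT A hA hTT' hM' using h
    refine ⟨fun s => A s, fun s => S.isInv_of_mem_compactsZY (hA s).1, ?_⟩
    rw [hM, ContinuousMap.sum_apply]
    exact Finset.sum_congr rfl fun s _ => by rw [hM']; rfl
  · rintro ⟨B, hB, rfl⟩
    choose T hT A hA hAB using fun s : Fin (n + 1) =>
      S.exists_compacts_eq (Set.finite_range fun u : Word N s => S.wordMap s u P) (B s) (hB s)
    choose T' hT' using fun s : Fin (n + 1) => b.exists_isAmpl s.is_le (hT s)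
    have hpi : b.IsPi (∑ s, T' s) (∑ s : Fin (n + 1), S.amplMat s s.is_le (A s)) :=
      ⟨T', _, fun s => ⟨T s, hT s, A s, hA s, hT' s, rfl⟩, rfl, rfl⟩
    let R : b.core n := ⟨∑ s, T' s, T', fun s => ⟨T s, hT s, hT' s⟩, rfl⟩
    refine ⟨R, R.2, ?_⟩
    rw [(b.existsUnique_isPi R).unique (b.isPi_piMap R) hpi, ContinuousMap.sum_apply]
    refine Finset.sum_congr rfl fun s _ => ?_
    ext a c
    simp only [amplMat, ampl, ContinuousMap.coe_mk, Matrix.of_apply,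
      hAB s _ (Set.mem_range_self _)]

/-! ### Paths through branched points -/

/-- The map h^(n-p) recovers the point at time p from the endpoint. -/
lemma AssumptionB.wordMap_take_eq {S : SelfSimilarMap K N} (b : S.AssumptionB) {n p : ℕ}
    (hp : p ≤ n) {w w' : Word N n} {y : K} (e : S.wordMap n w y = S.wordMap n w' y) :
    S.wordMap p (w.take p hp) y = S.wordMap p (w'.take p hp) y := by
  have := congrArg (b.h^[n - p]) e
  rwa [S.wordMap_take_drop hp, S.wordMap_take_drop hp w', b.iterate_wordMap,
    b.iterate_wordMap] at this

/-- A branched point from which the path reaches another branched point would be postcritical. -/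
lemma AssumptionB.notMem_branchSet_of_lt {S : SelfSimilarMap K N} (b : S.AssumptionB) {n p q : ℕ}
    (hpq : p < q) (hq : q ≤ n) (w : Word N n) (y : K)
    (h1 : S.wordMap p (w.take p (hpq.le.trans hq)) y ∈ S.branchSet) :
    S.wordMap q (w.take q hq) y ∉ S.branchSet := by
  intro h2
  rw [S.wordMap_split p (q - p) q (by omega)] at h2
  have : S.wordMap p (w.take p (hpq.le.trans hq)) y ∈ S.branchSet ∩ S.postcriticalSet :=
    ⟨h1, q - p, by omega, _, h2⟩
  rw [b.disjoint] at this
  exact this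

lemma AssumptionB.branch_time_unique {S : SelfSimilarMap K N} (b : S.AssumptionB) {n p q : ℕ}
    (hp : p ≤ n) (hq : q ≤ n) (w : Word N n) (y : K)
    (h1 : S.wordMap p (w.take p hp) y ∈ S.branchSet)
    (h2 : S.wordMap q (w.take q hq) y ∈ S.branchSet) : p = q := by
  rcases lt_trichotomy p q with h | h | h
  · exact absurd h2 (b.notMem_branchSet_of_lt h hq w y h1)
  · exact h
  · exact absurd h1 (b.notMem_branchSet_of_lt h hp w y h2)

/-- The two paths are at the same point before and after letter k, so two different maps γ_i agree
at the earlier point. -/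
lemma AssumptionB.mem_branchSet_of_letter_ne {S : SelfSimilarMap K N} (b : S.AssumptionB) {n : ℕ}
    {w w' : Word N n} {y : K} (e : S.wordMap n w y = S.wordMap n w' y) {k : Fin n}
    (hk : w k ≠ w' k) : S.wordMap (k + 1) (w.take (k + 1) k.2) y ∈ S.branchSet := by
  have e1 := b.wordMap_take_eq (p := k + 1) k.2 e
  have e0 := b.wordMap_take_eq (p := k) k.2.le e
  refine ⟨S.wordMap k (w.take k k.2.le) y, w k, w' k, hk, rfl, ?_⟩
  rw [e1, e0]
  rfl

/-- Each differing letter produces a branched point just after it, and a path meets only one. -/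
lemma AssumptionB.exists_branch_time {S : SelfSimilarMap K N} (b : S.AssumptionB) {n : ℕ}
    {w w' : Word N n} {y : K} (e : S.wordMap n w y = S.wordMap n w' y) (hne : w ≠ w') :
    ∃ k : Fin n, (∀ j, j ≠ k → w j = w' j) ∧
      S.wordMap (k + 1) (w.take (k + 1) k.2) y ∈ S.branchSet := by
  obtain ⟨k, hk⟩ := Function.ne_iff.1 hne
  have hB := b.mem_branchSet_of_letter_ne e hk
  refine ⟨k, fun j hj => ?_, hB⟩
  by_contra hjne
  have := b.branch_time_unique (p := k + 1) (q := j + 1) k.2 j.2 w y hB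
    (b.mem_branchSet_of_letter_ne e hjne)
  exact hj (Fin.ext (by omega))

lemma AssumptionB.wordMap_injective_of_mem {S : SelfSimilarMap K N} (b : S.AssumptionB) {n : ℕ}
    {R : K} (hR : R ∈ S.branchSet) {w w' : Word N n} (e : S.wordMap n w R = S.wordMap n w' R) :
    w = w' := by
  by_contra hne
  obtain ⟨k, -, hk⟩ := b.exists_branch_time e hne
  have : R ∈ S.branchSet ∩ S.postcriticalSet := ⟨hR, k + 1, by omega, _, hk⟩
  rw [b.disjoint] at this
  exact this

/-- Prolong a path to the common preimage of R by either of the two letters that map it to R. The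
path must start at P because h^p(R) = P. -/
lemma AssumptionB.exists_ne_of_mem_branchSet {S : SelfSimilarMap K N} (b : S.AssumptionB) {p : ℕ}
    (hp : 1 ≤ p) {P R : K} (hR : R ∈ S.branchSet) (hRP : b.h^[p] R = P) :
    ∃ u u' : Word N p, u ≠ u' ∧ S.wordMap p u P = R ∧ S.wordMap p u' P = R := by
  obtain ⟨q, rfl⟩ : ∃ q, p = q + 1 := ⟨p - 1, by omega⟩
  obtain ⟨a, i, j, hij, hi, hj⟩ := hR
  obtain ⟨w, y, rfl⟩ := S.exists_wordMap q a
  have hy : y = P := by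
    rw [← hRP, hi, Function.iterate_succ_apply, b.h_γ, b.iterate_wordMap]
  subst hy
  refine ⟨Fin.snoc w i, Fin.snoc w j, fun e => hij ?_, ?_, ?_⟩
  · simpa using congrFun e (Fin.last q)
  · simp [wordMap, hi]
  · simp [wordMap, hj]

lemma AssumptionB.index_eq {S : SelfSimilarMap K N} (b : S.AssumptionB) {n : ℕ} {P : K}
    {i j : b.Index n P} {w : Word N n} (hi : S.wordMap i.1.1 (w.take i.1.1 i.2.2.1) P = i.1.2)
    (hj : S.wordMap j.1.1 (w.take j.1.1 j.2.2.1) P = j.1.2) : i = j := by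
  have e := b.branch_time_unique i.2.2.1 j.2.2.1 w P (by rw [hi]; exact i.2.2.2.1)
    (by rw [hj]; exact j.2.2.2.1)
  obtain ⟨⟨p, R⟩, hi'⟩ := i
  obtain ⟨⟨q, R'⟩, hj'⟩ := j
  simp only at e
  subst e
  simp only at hi hj
  rw [hi] at hj
  subst hj
  rfl

/-! ### The projection `Q` -/

/-- The converse is interpolation at the single point P. -/
lemma mem_ZFiber (S : SelfSimilarMap K N) {n : ℕ} {P : K} {v : EuclideanSpace ℂ (Word N n)} :
    v ∈ S.ZFiber n P ↔ ∀ w w', S.wordMap n w P = S.wordMap n w' P → v w = v w' := by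
  constructor
  · rintro ⟨f, hf, hv⟩ w w' h
    rw [hv, hv, hf P w w' h]
  · intro hv
    obtain ⟨f, hf⟩ := S.exists_X_eq (Set.finite_singleton P)
      (fun y w => if y = P then v w else 0) (by
        intro y w w' h
        split_ifs with hy
        · subst hy; exact hv w w' h
        · rfl)
    refine ⟨S.phi f, S.phi_mem_Z f, fun w => ?_⟩
    have := hf P rfl w
    simp only [if_true] at this
    exact this.symm

/-- The columns of `M` lie in `Z_{γ^n}(P)`. -/
def ColInv (S : SelfSimilarMap K N) (n : ℕ) (P : K) (M : Mat N n) : Prop :=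
  ∀ v v' w, S.wordMap n v P = S.wordMap n v' P → M v w = M v' w

lemma star_Q (S : SelfSimilarMap K N) (n : ℕ) (P : K) : star (S.Q n P) = S.Q n P := by
  exact ((Matrix.toEuclideanCLM (n := Word N n) (𝕜 := ℂ)).symm.map_star' _).symm.trans
    (congrArg _ (isSelfAdjoint_starProjection _))

lemma Q_mulVec (S : SelfSimilarMap K N) {n : ℕ} {P : K} (v : Word N n → ℂ) :
    WithLp.toLp 2 ((S.Q n P).mulVec v) = (S.ZFiber n P).starProjection (WithLp.toLp 2 v) := by
  rw [← Matrix.toEuclideanCLM_toLp (𝕜 := ℂ), Q]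
  simp

/-- Together with `ColInv.Q_mul`, this turns invariance of columns into the equation QM = M. -/
lemma colInv_Q_mul (S : SelfSimilarMap K N) {n : ℕ} {P : K} (M : Mat N n) :
    S.ColInv n P (S.Q n P * M) := by
  intro v v' w h
  have h1 : WithLp.toLp 2 ((S.Q n P).mulVec (M.col w)) ∈ S.ZFiber n P := by
    rw [S.Q_mulVec]
    exact Submodule.starProjection_apply_mem _ _
  exact S.mem_ZFiber.1 h1 v v' h

lemma ColInv.Q_mul {S : SelfSimilarMap K N} {n : ℕ} {P : K} {M : Mat N n}
    (hM : S.ColInv n P M) : S.Q n P * M = M := by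
  ext v w
  have h1 : WithLp.toLp 2 (M.col w) ∈ S.ZFiber n P :=
    S.mem_ZFiber.2 fun v v' h => hM v v' w h
  have h2 := S.Q_mulVec (P := P) (M.col w)
  rw [Submodule.starProjection_eq_self_iff.2 h1] at h2
  exact congrFun (congrArg WithLp.ofLp h2) v

lemma Q_mul_Q (S : SelfSimilarMap K N) (n : ℕ) (P : K) : S.Q n P * S.Q n P = S.Q n P := by
  have := S.colInv_Q_mul (n := n) (P := P) 1
  rw [mul_one] at this
  exact this.Q_mul

lemma colInv_Q (S : SelfSimilarMap K N) (n : ℕ) (P : K) : S.ColInv n P (S.Q n P) := by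
  simpa using S.colInv_Q_mul (n := n) (P := P) 1

lemma isInv_iff (S : SelfSimilarMap K N) {n : ℕ} {P : K} {M : Mat N n} :
    S.IsInv n P M ↔ S.ColInv n P M ∧ S.ColInv n P (star M) := by
  constructor
  · intro h
    exact ⟨fun v v' w e => h v v' w w e rfl, fun v v' w e =>
      congrArg star (h w w v v' rfl e)⟩
  · rintro ⟨h1, h2⟩ v v' w w' e e'
    rw [h1 v v' w e]
    exact star_injective (h2 w w' v' e')

lemma IsInv.Q_mul {S : SelfSimilarMap K N} {n : ℕ} {P : K} {M : Mat N n}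
    (hM : S.IsInv n P M) : S.Q n P * M = M :=
  (S.isInv_iff.1 hM).1.Q_mul

lemma IsInv.star {S : SelfSimilarMap K N} {n : ℕ} {P : K} {M : Mat N n}
    (hM : S.IsInv n P M) : S.IsInv n P (star M) := by
  rw [isInv_iff] at hM ⊢
  rw [star_star]
  exact hM.symm

lemma IsInv.mul_Q {S : SelfSimilarMap K N} {n : ℕ} {P : K} {M : Mat N n}
    (hM : S.IsInv n P M) : M * S.Q n P = M := by
  apply star_injective
  rw [star_mul, S.star_Q, hM.star.Q_mul]

lemma isInv_Q_mul_Q (S : SelfSimilarMap K N) {n : ℕ} {P : K} (M : Mat N n) :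
    S.IsInv n P (S.Q n P * M * S.Q n P) := by
  rw [isInv_iff]
  constructor
  · rw [mul_assoc]
    exact S.colInv_Q_mul _
  · rw [star_mul, S.star_Q]
    exact S.colInv_Q_mul _

/-! ### The matrices `∑_u π_{n-p,u}(A)` -/

/-- `∑_u π_{n-p,u}(A)`, where `u` runs through the words of length `p` with `γ_u(P) = R`. -/
def branchMat (S : SelfSimilarMap K N) {n : ℕ} (P R : K) (p : ℕ) (hp : p ≤ n)
    (A : Mat N (n - p)) : Mat N n :=
  Matrix.of fun a c =>
    if S.wordMap p (a.take p hp) P = R ∧ a.take p hp = c.take p hp then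
      A (a.drop p) (c.drop p) else 0

lemma sum_blockMat (S : SelfSimilarMap K N) {n : ℕ} (P R : K) (p : ℕ) (hp : p ≤ n)
    (A : Mat N (n - p)) :
    ∑ u : Word N p with S.wordMap p u P = R, blockMat hp u A = S.branchMat P R p hp A := by
  ext a c
  rw [Matrix.sum_apply]
  simp only [blockMat, branchMat, Matrix.of_apply]
  by_cases h : S.wordMap p (a.take p hp) P = R ∧ a.take p hp = c.take p hp
  · rw [if_pos h, Finset.sum_eq_single (a.take p hp)]
    · rw [if_pos ⟨rfl, h.2.symm⟩]
    · intro u _ hu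
      rw [if_neg fun h => hu h.1.symm]
    · intro hn
      exact absurd (by simpa using h.1) hn
  · rw [if_neg h]
    refine Finset.sum_eq_zero fun u hu => if_neg ?_
    rintro ⟨rfl, h2⟩
    exact h ⟨(Finset.mem_filter.1 hu).2, h2.symm⟩

lemma branchMat_add (S : SelfSimilarMap K N) {n : ℕ} (P R : K) (p : ℕ) (hp : p ≤ n)
    (A B : Mat N (n - p)) :
    S.branchMat P R p hp (A + B) = S.branchMat P R p hp A + S.branchMat P R p hp B := by
  ext a c
  simp only [branchMat, Matrix.of_apply, Matrix.add_apply]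
  split_ifs <;> simp

lemma branchMat_smul (S : SelfSimilarMap K N) {n : ℕ} (P R : K) (p : ℕ) (hp : p ≤ n)
    (k : ℂ) (A : Mat N (n - p)) :
    S.branchMat P R p hp (k • A) = k • S.branchMat P R p hp A := by
  ext a c
  simp only [branchMat, Matrix.of_apply, Matrix.smul_apply]
  split_ifs <;> simp

lemma branchMat_zero (S : SelfSimilarMap K N) {n : ℕ} (P R : K) (p : ℕ) (hp : p ≤ n) :
    S.branchMat P R p hp (0 : Mat N (n - p)) = 0 := by
  ext a c
  simp [branchMat]

lemma branchMat_star (S : SelfSimilarMap K N) {n : ℕ} (P R : K) (p : ℕ) (hp : p ≤ n)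
    (A : Mat N (n - p)) :
    S.branchMat P R p hp (star A) = star (S.branchMat P R p hp A) := by
  ext a c
  simp only [branchMat, Matrix.of_apply, Matrix.star_apply]
  by_cases h : a.take p hp = c.take p hp
  · simp only [h]
    split_ifs <;> simp
  · rw [if_neg fun e => h e.2, if_neg fun e => h e.2.symm, star_zero]

lemma branchMat_mul_apply (S : SelfSimilarMap K N) {n : ℕ} (P R : K) (p : ℕ) (hp : p ≤ n)
    (A : Mat N (n - p)) (M : Mat N n) (a c : Word N n) :
    (S.branchMat P R p hp A * M) a c =
      if S.wordMap p (a.take p hp) P = R then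
        ∑ v, A (a.drop p) v * M (Word.join (a.take p hp) v) c else 0 := by
  have h1 : ∀ d : Word N n, S.branchMat P R p hp A a d * M d c =
      (if S.wordMap p (a.take p hp) P = R ∧ a.take p hp = d.take p hp then
        A (a.drop p) (d.drop p) else 0) * M (Word.join (d.take p hp) (d.drop p)) c := by
    intro d
    simp only [branchMat, Matrix.of_apply, Word.join_take_drop]
  rw [Matrix.mul_apply, Finset.sum_congr rfl fun d _ => h1 d, sum_word hp (fun u v =>
    (if S.wordMap p (a.take p hp) P = R ∧ a.take p hp = u then A (a.drop p) v else 0) *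
      M (Word.join u v) c), Finset.sum_eq_single (a.take p hp)]
  · by_cases h : S.wordMap p (a.take p hp) P = R
    · simp [h]
    · simp [h]
  · intro u _ hu
    simp [Ne.symm hu]
  · simp

lemma branchMat_mul (S : SelfSimilarMap K N) {n : ℕ} (P R : K) (p : ℕ) (hp : p ≤ n)
    (A B : Mat N (n - p)) :
    S.branchMat P R p hp (A * B) = S.branchMat P R p hp A * S.branchMat P R p hp B := by
  ext a c
  rw [branchMat_mul_apply]
  simp only [branchMat, Matrix.of_apply, Word.take_join, Word.drop_join]
  by_cases h : S.wordMap p (a.take p hp) P = R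
  · by_cases h2 : a.take p hp = c.take p hp
    · rw [if_pos ⟨h, h2⟩, if_pos h, Matrix.mul_apply]
      simp only [if_pos (show _ ∧ _ from ⟨h, h2⟩)]
    · simp [h2]
  · simp [h]

/-- A nonzero term in the product would need a word passing through both branched points at their
respective times, which `index_eq` excludes. -/
lemma AssumptionB.branchMat_mul_eq_zero {S : SelfSimilarMap K N} (b : S.AssumptionB) {n : ℕ}
    {P : K} {i j : b.Index n P} (hij : i ≠ j) (A : Mat N (n - i.1.1)) (B : Mat N (n - j.1.1)) :
    S.branchMat P i.1.2 i.1.1 i.2.2.1 A * S.branchMat P j.1.2 j.1.1 j.2.2.1 B = 0 := by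
  ext a c
  rw [branchMat_mul_apply, Matrix.zero_apply]
  split_ifs with h
  · refine Finset.sum_eq_zero fun v _ => ?_
    simp only [branchMat, Matrix.of_apply]
    rw [if_neg, mul_zero]
    rintro ⟨h2, -⟩
    exact hij (b.index_eq (w := Word.join (a.take i.1.1 i.2.2.1) v)
      (by rw [Word.take_join, h]) h2)
  · rfl

/-- Rows with a common endpoint also share the point at time p. If that point is R, the remaining
letters agree as well, so the same coefficients of A occur in both rows. -/
lemma AssumptionB.colInv_branchMat_mul {S : SelfSimilarMap K N} (b : S.AssumptionB) {n p : ℕ}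
    {P R : K} (hp : p ≤ n) (hR : R ∈ S.branchSet) (A : Mat N (n - p)) {M : Mat N n}
    (hM : S.ColInv n P M) : S.ColInv n P (S.branchMat P R p hp A * M) := by
  intro a a' c e
  have e0 := b.wordMap_take_eq hp e
  rw [branchMat_mul_apply, branchMat_mul_apply, ← e0]
  split_ifs with h
  · have hd : a.drop p = a'.drop p := by
      rw [S.wordMap_take_drop hp, S.wordMap_take_drop hp a', ← e0, h] at e
      exact b.wordMap_injective_of_mem hR e
    rw [hd]
    refine Finset.sum_congr rfl fun v _ => congrArg _ (hM _ _ _ ?_)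
    rw [S.wordMap_take_drop hp, S.wordMap_take_drop hp (Word.join (a'.take p hp) v),
      Word.take_join, Word.take_join, Word.drop_join, Word.drop_join, e0]
  · rfl

/-- The range of Q is invariant under the branch matrices of both A and A*, hence it is a reducing
subspace. -/
lemma AssumptionB.commute_branchMat {S : SelfSimilarMap K N} (b : S.AssumptionB) {n p : ℕ}
    {P R : K} (hp : p ≤ n) (hR : R ∈ S.branchSet) (A : Mat N (n - p)) :
    Commute (S.Q n P) (S.branchMat P R p hp A) := by
  have h1 := fun A => (b.colInv_branchMat_mul hp hR A (S.colInv_Q n P)).Q_mul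
  have h2 := congrArg star (h1 (star A))
  rw [branchMat_star] at h2
  simp only [star_mul, star_star, S.star_Q] at h2
  rw [commute_iff_eq, ← h2, ← h1 A, mul_assoc]

/-- The `*`-homomorphism `A ↦ (I - Q) ∑_u π_{n-p,u}(A)` with range `C(P, R, p)`. -/
def AssumptionB.branchHom {S : SelfSimilarMap K N} (b : S.AssumptionB) {n : ℕ} {P : K}
    (i : b.Index n P) : Mat N (n - i.1.1) →⋆ₙₐ[ℂ] Mat N n where
  toFun A := (1 - S.Q n P) * S.branchMat P i.1.2 i.1.1 i.2.2.1 A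
  map_smul' k A := by simp [branchMat_smul]
  map_zero' := by rw [branchMat_zero, mul_zero]
  map_add' A B := by rw [branchMat_add, mul_add]
  map_mul' A B := by
    have h1 := ((Commute.one_left _).sub_left
      (b.commute_branchMat (P := P) i.2.2.1 i.2.2.2.1 A)).eq
    have h2 : (1 - S.Q n P) * (1 - S.Q n P) = 1 - S.Q n P := by
      simp [mul_sub, sub_mul, S.Q_mul_Q]
    rw [mul_assoc, ← mul_assoc _ (1 - S.Q n P), ← h1, mul_assoc, ← mul_assoc (1 - S.Q n P), h2,
      branchMat_mul]
  map_star' A := by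
    have h1 := ((Commute.one_left _).sub_left
      (b.commute_branchMat (P := P) i.2.2.1 i.2.2.2.1 A)).eq
    rw [h1, star_mul, star_sub, star_one, S.star_Q, branchMat_star]

lemma AssumptionB.branchHom_apply {S : SelfSimilarMap K N} (b : S.AssumptionB) {n : ℕ} {P : K}
    (i : b.Index n P) (A : Mat N (n - i.1.1)) :
    b.branchHom i A = (1 - S.Q n P) * S.branchMat P i.1.2 i.1.1 i.2.2.1 A := rfl

/-- If the image of A vanishes, the branch matrix has invariant columns. Passing from u to another
word u' with the same endpoint R then equates each entry of A with an entry off the diagonal blocks,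
which is zero. -/
lemma AssumptionB.branchHom_injective {S : SelfSimilarMap K N} (b : S.AssumptionB) {n : ℕ} {P : K}
    (i : b.Index n P) : Function.Injective (b.branchHom i) := by
  rw [injective_iff_map_eq_zero]
  intro A hA
  have h1 : S.ColInv n P (S.branchMat P i.1.2 i.1.1 i.2.2.1 A) := by
    rw [branchHom_apply, sub_mul, one_mul, sub_eq_zero] at hA
    rw [hA]
    exact S.colInv_Q_mul _
  obtain ⟨u, u', hne, hu, hu'⟩ := b.exists_ne_of_mem_branchSet i.2.1 i.2.2.2.1 i.2.2.2.2
  ext v v'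
  have := h1 (Word.join u v) (Word.join u' v) (Word.join u v') (by
    rw [S.wordMap_take_drop i.2.2.1, S.wordMap_take_drop i.2.2.1 (Word.join u' v),
      Word.take_join, Word.take_join, Word.drop_join, Word.drop_join, hu, hu'])
  rw [Matrix.zero_apply]
  simpa only [branchMat, Matrix.of_apply, Word.take_join, Word.drop_join, hu, hu', hne.symm,
    and_self, if_true, and_false, if_false] using this

lemma AssumptionB.Q_mul_branchHom {S : SelfSimilarMap K N} (b : S.AssumptionB) {n : ℕ} {P : K}
    (i : b.Index n P) (A : Mat N (n - i.1.1)) : S.Q n P * b.branchHom i A = 0 := by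
  rw [branchHom_apply, ← mul_assoc, mul_sub, mul_one, S.Q_mul_Q, sub_self, zero_mul]

lemma AssumptionB.branchHom_mul_Q {S : SelfSimilarMap K N} (b : S.AssumptionB) {n : ℕ} {P : K}
    (i : b.Index n P) (A : Mat N (n - i.1.1)) : b.branchHom i A * S.Q n P = 0 := by
  apply star_injective
  rw [star_mul, S.star_Q, ← map_star, Q_mul_branchHom, star_zero]

lemma AssumptionB.branchHom_mul_branchHom {S : SelfSimilarMap K N} (b : S.AssumptionB) {n : ℕ}
    {P : K} {i j : b.Index n P} (hij : i ≠ j) (A : Mat N (n - i.1.1)) (B : Mat N (n - j.1.1)) :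
    b.branchHom i A * b.branchHom j B = 0 := by
  have h1 := ((Commute.one_left _).sub_left
      (b.commute_branchMat (P := P) i.2.2.1 i.2.2.2.1 A)).eq
  rw [branchHom_apply, branchHom_apply, mul_assoc, ← mul_assoc _ (1 - S.Q n P), ← h1, mul_assoc,
    b.branchMat_mul_eq_zero hij, mul_zero, mul_zero]

/-! ### Decomposition of the fibers of the core -/

lemma wordMap_take_join_drop (S : SelfSimilarMap K N) {n p s : ℕ} (h : p ≤ s) (hs : s ≤ n)
    {u : Word N p} {d : Word N n} {y : K}
    (e : S.wordMap p u y = S.wordMap p (d.take p (h.trans hs)) y) :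
    S.wordMap s ((Word.join u (d.drop p)).take s hs) y = S.wordMap s (d.take s hs) y := by
  rw [S.wordMap_split p (s - p) s (by omega), S.wordMap_split p (s - p) s (by omega) (d.take s hs)]
  have h1 : (fun i : Fin (s - p) => (Word.join u (d.drop p)).take s hs ⟨p + i, by omega⟩) =
      fun i : Fin (s - p) => d.take s hs ⟨p + i, by omega⟩ :=
    funext fun i => Word.join_drop_apply u d (j := ⟨p + i, by omega⟩) (Nat.le_add_right _ _)
  have h2 : (fun i : Fin p => (Word.join u (d.drop p)).take s hs ⟨i, by omega⟩) = u :=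
    funext fun i => Word.join_apply_of_lt u (d.drop p) (j := ⟨i, by omega⟩) i.2
  rw [h1, h2, e]
  rfl

lemma ampl_star (S : SelfSimilarMap K N) {n : ℕ} (s : ℕ) (hs : s ≤ n) (y : K)
    (B : K → Mat N (n - s)) :
    S.ampl s hs y (fun z => star (B z)) = star (S.ampl s hs y B) := by
  ext a c
  simp only [ampl, Matrix.of_apply, Matrix.star_apply]
  by_cases h : a.take s hs = c.take s hs
  · simp [h]
  · rw [if_neg h, if_neg (Ne.symm h), star_zero]

/-- A word of length `p` that leads from `P` to `R`. -/
lemma AssumptionB.exists_word {S : SelfSimilarMap K N} (b : S.AssumptionB) {n : ℕ} {P : K}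
    (i : b.Index n P) : ∃ u : Word N i.1.1, S.wordMap i.1.1 u P = i.1.2 := by
  obtain ⟨u, -, -, h, -⟩ := b.exists_ne_of_mem_branchSet i.2.1 i.2.2.2.1 i.2.2.2.2
  exact ⟨u, h⟩

/-- The diagonal block of `D` at a word from `P` to `R`, if `p ≤ s`. -/
def AssumptionB.coeff {S : SelfSimilarMap K N} (b : S.AssumptionB) {n : ℕ} {P : K} (s : ℕ)
    (D : Mat N n) (i : b.Index n P) : Mat N (n - i.1.1) :=
  if i.1.1 ≤ s then Matrix.of fun v v' =>
    D (Word.join (b.exists_word i).choose v) (Word.join (b.exists_word i).choose v') else 0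

lemma AssumptionB.coeff_star {S : SelfSimilarMap K N} (b : S.AssumptionB) {n : ℕ} {P : K} (s : ℕ)
    (D : Mat N n) (i : b.Index n P) : b.coeff s (star D) i = star (b.coeff s D i) := by
  unfold coeff
  split_ifs
  · rfl
  · exact (star_zero _).symm

/-- From time p on, the block of an amplification depends on the point reached and not on how it was
reached. Every word from P to R thus carries the same diagonal block, so the choice made in `coeff`
is harmless. -/
lemma AssumptionB.ampl_apply_eq_branchMat {S : SelfSimilarMap K N} (b : S.AssumptionB) {n : ℕ}
    {P : K} {s : ℕ} (hs : s ≤ n) (B : K → Mat N (n - s)) (i : b.Index n P) (hi : i.1.1 ≤ s)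
    {d : Word N n} (hd : S.wordMap i.1.1 (d.take i.1.1 i.2.2.1) P = i.1.2) (c : Word N n) :
    S.ampl s hs P B d c =
      S.branchMat P i.1.2 i.1.1 i.2.2.1 (b.coeff s (S.ampl s hs P B) i) d c := by
  have hu := (b.exists_word i).choose_spec
  have h1 := S.wordMap_take_join_drop hi hs (hu.trans hd.symm)
  have h2 := Word.take_eq_iff_of_le hi hs (b.exists_word i).choose d c
  simp only [branchMat, Matrix.of_apply, coeff, if_pos hi, ampl, h1, hd, true_and,
    Word.drop_join_drop hi, h2]
  by_cases h : d.take i.1.1 i.2.2.1 = c.take i.1.1 i.2.2.1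
  · simp only [h, true_and, if_true]
  · simp only [h, false_and, if_false]

lemma AssumptionB.colInv_ampl_sub {S : SelfSimilarMap K N} (b : S.AssumptionB) {n : ℕ} {P : K}
    {s : ℕ} (hs : s ≤ n) (B : K → Mat N (n - s)) (hB : ∀ y, S.IsInv (n - s) y (B y)) :
    S.ColInv n P (S.ampl s hs P B - ∑ i : b.Index n P,
      S.branchMat P i.1.2 i.1.1 i.2.2.1 (b.coeff s (S.ampl s hs P B) i)) := by
  intro a a' c e
  by_cases hne : a = a'
  · rw [hne]
  obtain ⟨k, hk, hkB⟩ := b.exists_branch_time e hne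
  let i : b.Index n P := ⟨(k + 1, S.wordMap (k + 1) (a.take (k + 1) k.2) P),
    by simp, k.2, hkB, b.iterate_wordMap _ _ _⟩
  -- The row of d meets only the branch matrix of the unique branched point on its path.
  have hsum : ∀ A : (i : b.Index n P) → Mat N (n - i.1.1), ∀ d : Word N n,
      S.wordMap (k + 1) (d.take (k + 1) k.2) P = S.wordMap (k + 1) (a.take (k + 1) k.2) P →
      (∑ i : b.Index n P, S.branchMat P i.1.2 i.1.1 i.2.2.1 (A i)) d c =
        S.branchMat P i.1.2 i.1.1 i.2.2.1 (A i) d c := by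
    intro A d hd
    rw [Matrix.sum_apply, Finset.sum_eq_single i]
    · intro j _ hj
      simp only [branchMat, Matrix.of_apply]
      exact if_neg fun h => hj (b.index_eq h.1 hd)
    · exact fun h => absurd (Finset.mem_univ _) h
  have ha' : S.wordMap (k + 1) (a'.take (k + 1) k.2) P =
      S.wordMap (k + 1) (a.take (k + 1) k.2) P := (b.wordMap_take_eq k.2 e).symm
  rw [Matrix.sub_apply, Matrix.sub_apply, hsum _ a rfl, hsum _ a' ha']
  -- If branching occurs by time s, the branch matrix cancels both rows entirely. Otherwise its
  -- coefficient is zero, the first s letters of a and a' agree, and invariance of B equates the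
  -- rows.
  by_cases hks : (k : ℕ) + 1 ≤ s
  · rw [b.ampl_apply_eq_branchMat hs B i hks rfl, b.ampl_apply_eq_branchMat hs B i hks ha',
      sub_self, sub_self]
  · have h0 : b.coeff s (S.ampl s hs P B) i = 0 := if_neg hks
    have ht : a.take s hs = a'.take s hs := funext fun j => hk _ (by
      intro h
      have := congrArg Fin.val h
      simp only at this
      omega)
    have hd := e
    rw [S.wordMap_take_drop hs, S.wordMap_take_drop hs a', ← ht] at hd
    rw [h0, branchMat_zero]
    simp only [ampl, Matrix.of_apply, Matrix.zero_apply, ← ht, hB _ _ _ _ _ hd rfl]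

lemma AssumptionB.exists_decomp_ampl {S : SelfSimilarMap K N} (b : S.AssumptionB) {n : ℕ} {P : K}
    {s : ℕ} (hs : s ≤ n) (B : K → Mat N (n - s)) (hB : ∀ y, S.IsInv (n - s) y (B y)) :
    ∃ A : (i : b.Index n P) → Mat N (n - i.1.1),
      (1 - S.Q n P) * S.ampl s hs P B = ∑ i, b.branchHom i (A i) ∧
      S.ampl s hs P B * (1 - S.Q n P) = ∑ i, b.branchHom i (A i) := by
  have key : ∀ B : K → Mat N (n - s), (∀ y, S.IsInv (n - s) y (B y)) →
      (1 - S.Q n P) * S.ampl s hs P B =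
        ∑ i : b.Index n P, b.branchHom i (b.coeff s (S.ampl s hs P B) i) := by
    intro B hB
    have h := (b.colInv_ampl_sub (P := P) hs B hB).Q_mul
    simp only [branchHom_apply]
    rw [← Finset.mul_sum, ← sub_eq_zero, ← mul_sub, sub_mul, one_mul, h, sub_self]
  refine ⟨_, key B hB, ?_⟩
  -- Applying the identity to the adjoint gives the right-hand version with the same coefficients,
  -- because `coeff` and `branchHom` respect adjoints.
  have h := congrArg star (key _ fun y => (hB y).star)
  rw [ampl_star, star_mul, star_star, star_sub, star_one, S.star_Q, star_sum] at h
  rw [h]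
  refine Finset.sum_congr rfl fun i _ => ?_
  rw [coeff_star, map_star, star_star]

/-- The fiber of the finite core, as an additive submonoid. -/
def AssumptionB.coreFiber [CompactSpace K] {S : SelfSimilarMap K N} (b : S.AssumptionB) (n : ℕ)
    (P : K) : AddSubmonoid (Mat N n) where
  carrier := b.fiber (b.core n) P
  zero_mem' := b.mem_fiber_core.2 ⟨0, fun s y v v' w w' _ _ => rfl, by
    refine (Finset.sum_eq_zero fun s _ => ?_).symm
    ext a c
    simp [ampl]⟩
  add_mem' := by
    intro M M' hM hM'
    obtain ⟨B, hB, rfl⟩ := b.mem_fiber_core.1 hM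
    obtain ⟨B', hB', rfl⟩ := b.mem_fiber_core.1 hM'
    refine b.mem_fiber_core.2 ⟨B + B', fun s y v v' w w' h h' =>
      congrArg₂ (· + ·) (hB s y v v' w w' h h') (hB' s y v v' w w' h h'), ?_⟩
    rw [← Finset.sum_add_distrib]
    refine Finset.sum_congr rfl fun s _ => ?_
    ext a c
    simp only [ampl, Matrix.of_apply, Matrix.add_apply, Pi.add_apply]
    split_ifs <;> simp

lemma AssumptionB.isInv_mem_coreFiber [CompactSpace K] {S : SelfSimilarMap K N}
    (b : S.AssumptionB) {n : ℕ} {P : K} {M : Mat N n} (hM : S.IsInv n P M) :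
    M ∈ b.coreFiber n P := by
  obtain ⟨T, -, h⟩ := b.mem_fiber_compacts.2 hM
  exact ⟨T, T.2, h⟩

/-- It is an amplification with s = p of the function equal to A at R and 0 elsewhere. Any A is
invariant at R, since distinct words from R have distinct endpoints. -/
lemma AssumptionB.branchMat_mem_coreFiber [CompactSpace K] {S : SelfSimilarMap K N}
    (b : S.AssumptionB) {n p : ℕ} {P R : K} (hp : p ≤ n) (hR : R ∈ S.branchSet)
    (A : Mat N (n - p)) : S.branchMat P R p hp A ∈ b.coreFiber n P := by
  let t : Fin (n + 1) := ⟨p, by omega⟩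
  let B : (s : Fin (n + 1)) → K → Mat N (n - s) := Pi.single t (Pi.single R A)
  have hBt : B t = Pi.single R A := Pi.single_eq_same _ _
  have hBne : ∀ s, s ≠ t → B s = 0 := fun s hs => Pi.single_eq_of_ne hs _
  refine b.mem_fiber_core.2 ⟨B, fun s y => ?_, ?_⟩
  · by_cases hs : s = t
    · subst hs
      rw [hBt]
      by_cases hy : y = R
      · subst hy
        intro v v' w w' h h'
        rw [b.wordMap_injective_of_mem hR h, b.wordMap_injective_of_mem hR h']
      · rw [Pi.single_eq_of_ne hy]
        exact fun v v' w w' _ _ => rfl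
    · rw [hBne s hs]
      exact fun v v' w w' _ _ => rfl
  · rw [Finset.sum_eq_single t]
    · rw [hBt]
      ext a c
      simp only [branchMat, ampl, Matrix.of_apply, t]
      by_cases h : S.wordMap p (a.take p hp) P = R
      · simp [h]
      · simp [h]
    · intro s _ hs
      rw [hBne s hs]
      ext a c
      simp [ampl]
    · simp

lemma AssumptionB.branchHom_mem_coreFiber [CompactSpace K] {S : SelfSimilarMap K N}
    (b : S.AssumptionB) {n : ℕ} {P : K} (i : b.Index n P) (A : Mat N (n - i.1.1)) :
    b.branchHom i A ∈ b.coreFiber n P := by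
  -- As Q commutes with the branch matrix, the correction -QT lies in the corner, which is already
  -- part of the core's fiber.
  have h : b.branchHom i A = S.branchMat P i.1.2 i.1.1 i.2.2.1 A +
      S.Q n P * (-S.branchMat P i.1.2 i.1.1 i.2.2.1 A) * S.Q n P := by
    rw [mul_neg, neg_mul, (b.commute_branchMat i.2.2.1 i.2.2.2.1 A).eq, mul_assoc, S.Q_mul_Q,
      ← (b.commute_branchMat i.2.2.1 i.2.2.2.1 A).eq, branchHom_apply, sub_mul, one_mul,
      sub_eq_add_neg]
  rw [h]
  exact add_mem (b.branchMat_mem_coreFiber _ i.2.2.2.1 A)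
    (b.isInv_mem_coreFiber (S.isInv_Q_mul_Q _))

theorem AssumptionB.mem_fiber_core_iff_decomp [CompactSpace K] {S : SelfSimilarMap K N}
    (b : S.AssumptionB) {n : ℕ} {P : K} {M : Mat N n} :
    M ∈ b.fiber (b.core n) P ↔ ∃ k, S.IsInv n P k ∧
      ∃ A : (i : b.Index n P) → Mat N (n - i.1.1), M = k + ∑ i, b.branchHom i (A i) := by
  constructor
  · intro hM
    obtain ⟨B, hB, hMB⟩ := b.mem_fiber_core.1 hM
    choose A h1 h2 using fun s : Fin (n + 1) => b.exists_decomp_ampl (P := P) s.is_le (B s) (hB s)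
    have hA : ∑ i : b.Index n P, b.branchHom i (∑ s, A s i) =
        ∑ s, ∑ i, b.branchHom i (A s i) := by
      rw [Finset.sum_comm]
      exact Finset.sum_congr rfl fun i _ => map_sum _ _ _
    have h3 : (1 - S.Q n P) * M = ∑ i : b.Index n P, b.branchHom i (∑ s, A s i) := by
      rw [hA, hMB, Finset.mul_sum]
      exact Finset.sum_congr rfl fun s _ => h1 s
    have h4 : M * (1 - S.Q n P) = ∑ i : b.Index n P, b.branchHom i (∑ s, A s i) := by
      rw [hA, hMB, Finset.sum_mul]
      exact Finset.sum_congr rfl fun s _ => h2 s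
    -- The left and right compressions by I - Q coincide, so M has no off-diagonal part with respect
    -- to Q.
    have h5 : S.Q n P * M = M * S.Q n P := by
      have := h3.trans h4.symm
      rwa [sub_mul, mul_sub, one_mul, mul_one, sub_right_inj] at this
    refine ⟨S.Q n P * M * S.Q n P, S.isInv_Q_mul_Q M, fun i => ∑ s, A s i, ?_⟩
    rw [← h3, h5, mul_assoc, S.Q_mul_Q, sub_mul, one_mul, h5, add_sub_cancel]
  · rintro ⟨k, hk, A, rfl⟩
    exact add_mem (S := AddSubmonoid (Mat N n)) (s := b.coreFiber n P) (b.isInv_mem_coreFiber hk)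
      (sum_mem fun i _ => b.branchHom_mem_coreFiber i (A i))

/-! ### The direct sum -/

/-- The `*`-algebra `Q M_{N^n}(ℂ) Q` of invariant matrices. -/
def invSubalgebra (S : SelfSimilarMap K N) (n : ℕ) (P : K) :
    NonUnitalStarSubalgebra ℂ (Mat N n) where
  carrier := {M | S.IsInv n P M}
  add_mem' h h' v v' w w' e e' := congrArg₂ (· + ·) (h v v' w w' e e') (h' v v' w w' e e')
  zero_mem' _ _ _ _ _ _ := rfl
  mul_mem' {M M'} h h' v v' w w' e e' := by
    rw [Matrix.mul_apply, Matrix.mul_apply]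
    exact Finset.sum_congr rfl fun x _ =>
      congrArg₂ (· * ·) (h v v' x x e rfl) (h' x x w w' rfl e')
  smul_mem' c M h v v' w w' e e' := congrArg (c * ·) (h v v' w w' e e')
  star_mem' h := IsInv.star h

/-- The `*`-algebra `C(P, R, p)`. -/
def AssumptionB.branchSubalgebra {S : SelfSimilarMap K N} (b : S.AssumptionB) {n : ℕ} {P : K}
    (i : b.Index n P) : NonUnitalStarSubalgebra ℂ (Mat N n) :=
  NonUnitalStarAlgHom.range (b.branchHom i)

lemma AssumptionB.coe_branchSubalgebra {S : SelfSimilarMap K N} (b : S.AssumptionB) {n : ℕ}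
    {P : K} (i : b.Index n P) :
    (b.branchSubalgebra i : Set (Mat N n)) = S.CBlock P i.1.2 i.1.1 i.2.2.1 := by
  ext M
  constructor
  · rintro ⟨A, rfl⟩
    exact ⟨_, ⟨A, rfl⟩, by rw [sum_blockMat]; rfl⟩
  · rintro ⟨_, ⟨A, rfl⟩, rfl⟩
    exact ⟨A, by rw [sum_blockMat]; rfl⟩

/-- The `*`-isomorphism of `C(P, R, p)` with a full matrix algebra. -/
lemma AssumptionB.nonempty_branchSubalgebra_equiv {S : SelfSimilarMap K N} (b : S.AssumptionB)
    {n : ℕ} {P : K} (i : b.Index n P) : Nonempty (b.branchSubalgebra i ≃⋆ₐ[ℂ]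
      Matrix (Fin (N ^ (n - i.1.1))) (Fin (N ^ (n - i.1.1))) ℂ) := by
  let e : Word N (n - i.1.1) ≃ Fin (N ^ (n - i.1.1)) :=
    Fintype.equivFinOfCardEq (by simp)
  let r : Mat N (n - i.1.1) ≃⋆ₐ[ℂ] Matrix (Fin (N ^ (n - i.1.1))) (Fin (N ^ (n - i.1.1))) ℂ :=
    StarAlgEquiv.ofAlgEquiv (Matrix.reindexAlgEquiv ℂ ℂ e) fun A => by ext; rfl
  exact ⟨(StarAlgEquiv.ofInjective' _ (b.branchHom_injective i)).symm.trans r⟩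

/-- `(k, c) ↦ k + ∑ c_{R,p}` -/
def AssumptionB.sumHom {S : SelfSimilarMap K N} (b : S.AssumptionB) (n : ℕ) (P : K) :
    (S.invSubalgebra n P × (∀ i : b.Index n P, b.branchSubalgebra i)) →⋆ₙₐ[ℂ] Mat N n where
  toFun x := x.1 + ∑ i, (x.2 i : Mat N n)
  map_smul' c x := by simp [Finset.smul_sum]
  map_zero' := by simp
  map_add' x y := by
    simp [Finset.sum_add_distrib, add_add_add_comm]
  map_mul' := by
    rintro ⟨k, c⟩ ⟨l, d⟩
    have hQk : (k : Mat N n) = k * S.Q n P := (IsInv.mul_Q k.2).symm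
    have hQl : (l : Mat N n) = S.Q n P * l := (IsInv.Q_mul l.2).symm
    have h1 : ∀ i, (k : Mat N n) * (d i : Mat N n) = 0 := by
      intro i
      obtain ⟨A, hA⟩ := (d i).2
      rw [← hA, hQk, mul_assoc]
      exact (congrArg _ (b.Q_mul_branchHom i A)).trans (mul_zero _)
    have h2 : ∀ i, (c i : Mat N n) * (l : Mat N n) = 0 := by
      intro i
      obtain ⟨A, hA⟩ := (c i).2
      rw [← hA, hQl, ← mul_assoc]
      exact (congrArg (· * _) (b.branchHom_mul_Q i A)).trans (zero_mul _)
    have h3 : ∀ i j, i ≠ j → (c i : Mat N n) * (d j : Mat N n) = 0 := by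
      intro i j hij
      obtain ⟨A, hA⟩ := (c i).2
      obtain ⟨B, hB⟩ := (d j).2
      rw [← hA, ← hB]
      exact b.branchHom_mul_branchHom hij A B
    have h4 : (∑ i, (c i : Mat N n)) * ∑ j, (d j : Mat N n) = ∑ i, (c i : Mat N n) * d i := by
      rw [Finset.sum_mul_sum]
      exact Finset.sum_congr rfl fun i _ =>
        Finset.sum_eq_single i (fun j _ hj => h3 i j hj.symm) (by simp)
    simp only [Prod.fst_mul, Prod.snd_mul, Pi.mul_apply, NonUnitalStarSubalgebra.coe_mul]
    rw [mul_add, add_mul, add_mul, h4, Finset.mul_sum, Finset.sum_mul,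
      Finset.sum_eq_zero fun i _ => h1 i, Finset.sum_eq_zero fun i _ => h2 i, add_zero, zero_add]
  map_star' x := by simp

/-- Multiplication by Q isolates the component k, and multiplication by the unit of one C(P, R, p)
isolates its component. -/
lemma AssumptionB.sumHom_injective {S : SelfSimilarMap K N} (b : S.AssumptionB) (n : ℕ) (P : K) :
    Function.Injective (b.sumHom n P) := by
  rw [injective_iff_map_eq_zero]
  rintro ⟨⟨k, hk⟩, c⟩ h
  choose A hA using fun i => (c i).2
  have h0 : k + ∑ i, b.branchHom i (A i) = 0 := by
    rw [← h]
    exact congrArg (k + ·) (Finset.sum_congr rfl fun i _ => hA i)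
  have hk0 : k = 0 := by
    have := congrArg (S.Q n P * ·) h0
    simpa only [mul_add, Finset.mul_sum, b.Q_mul_branchHom, Finset.sum_const_zero, add_zero,
      IsInv.Q_mul hk, mul_zero] using this
  subst hk0
  rw [zero_add] at h0
  have hc : ∀ i, c i = 0 := by
    intro i
    have h1 := congrArg (· * b.branchHom i 1) h0
    simp only [Finset.sum_mul, zero_mul] at h1
    rw [Finset.sum_eq_single i (fun j _ hj => b.branchHom_mul_branchHom hj _ _) (by simp),
      ← map_mul, mul_one] at h1
    exact Subtype.ext ((hA i).symm.trans h1)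
  exact Prod.ext rfl (funext hc)

lemma AssumptionB.coe_range_sumHom [CompactSpace K] {S : SelfSimilarMap K N} (b : S.AssumptionB)
    (n : ℕ) (P : K) : (NonUnitalStarAlgHom.range (b.sumHom n P) : Set (Mat N n)) =
      b.fiber (b.core n) P := by
  ext M
  rw [b.mem_fiber_core_iff_decomp]
  constructor
  · rintro ⟨⟨⟨k, hk⟩, c⟩, rfl⟩
    choose A hA using fun i => (c i).2
    exact ⟨k, hk, A, congrArg (k + ·) (Finset.sum_congr rfl fun i _ => (hA i).symm)⟩
  · rintro ⟨k, hk, A, rfl⟩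
    exact ⟨(⟨k, hk⟩, fun i => ⟨b.branchHom i (A i), A i, rfl⟩), rfl⟩

end SelfSimilarMap

end

theorem mainTheorem6 {K : Type*} [MetricSpace K] [CompactSpace K] {N : ℕ}
    (S : SelfSimilarMap K N) (b : S.AssumptionB) (n : ℕ) (P : K) (hP : P ∈ S.postcriticalSet) :
    ∃ (F C₀ : NonUnitalStarSubalgebra ℂ (Mat N n))
      (C : b.Index n P → NonUnitalStarSubalgebra ℂ (Mat N n)),
      (F : Set (Mat N n)) = b.fiber (b.core n) P ∧
      (C₀ : Set (Mat N n)) = b.fiber (S.compacts n) P ∧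
      (∀ i, (C i : Set (Mat N n)) = S.CBlock P i.1.2 i.1.1 i.2.2.1) ∧
      (∀ i, Nonempty
        (C i ≃⋆ₐ[ℂ] Matrix (Fin (N ^ (n - i.1.1))) (Fin (N ^ (n - i.1.1))) ℂ)) ∧
      ∃ Φ : (C₀ × (∀ i, C i)) ≃⋆ₐ[ℂ] F,
        ∀ (k : C₀) (c : ∀ i, C i), (Φ (k, c) : Mat N n) = k + ∑ i, (c i : Mat N n) := by
  refine ⟨NonUnitalStarAlgHom.range (b.sumHom n P), S.invSubalgebra n P, b.branchSubalgebra,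
    b.coe_range_sumHom n P, Set.ext fun M => b.mem_fiber_compacts.symm, b.coe_branchSubalgebra,
    b.nonempty_branchSubalgebra_equiv, StarAlgEquiv.ofInjective' _ (b.sumHom_injective n P),
    fun k c => rfl⟩
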